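/- **Theorem (discrete weak duality).** Let $n\ge 2$, let $\Omega\subset\mathbb R^n$ be a bounded open set that is the interior of its closure (for instance a bounded polyhedral Lipschitz domain), and let $\Gamma_{\rm D}\subset\partial\Omega$ be nonempty and closed. Write $\mathbb M=\mathbb R^{m\times n}$ with the Frobenius product $A:B$. *Mesh.* A polytope is a finite union of nondegenerate closed $n$-simplices. Let $\mathcal M$ be a finite family of polytopes of positive volume, with pairwise intersections of measure zero and $\bigcup_{K\in\mathcal M}K=\overline\Omega$. Let $\Sigma$ be a finite family of closed connected subsets of hyperplanes (faces), with positive $(n-1)$-dimensional surface measure and pairwise intersections of surface measure zero, covering the skeleton: $\bigcup_{S\in\Sigma}S=\bigcup_{K\in\mathcal M}\partial K$. Each $S\in\Sigma$ carries a unit normal $\nu_S$. It lies in $\partial K_+$ for a cell $K_+=K_+(S)$ with outward unit normal $\nu_S$ along $S$, and either (interior face) also in $\partial K_-$ for a cell $K_-=K_-(S)$ with outward unit normal $-\nu_S$ along $S$, or (boundary face) in $\partial\Omega$. (The outward normal of $K$ along $S$ is $\nu$ if, for surface-a.e. $x\in S$, $K$ agrees near $x$ with $\{y:(y-x)\cdot\nu\le0\}$.)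 Put $\Sigma(K)=\{S\in\Sigma: S\subset\partial K\}$, $\Sigma_{\rm D}=\{S\in\Sigma: S\subset\Gamma_{\rm D}\}$, let $\Sigma_{\rm N}$ be the set of the boundary faces that are not in $\Sigma_{\rm D}$, and $h_S=\operatorname{diam}S$. Jumps are $[a]_S=a|_{K_+}-a|_{K_-}$ on interior faces and $[a]_S=a|_{K_+}$ on boundary faces. The subscript pw marks cellwise derivatives. *Spaces.* Fix $k\in\mathbb N_0$. $P_k(\mathcal M;\cdot)$ and $P_k(\Sigma;\cdot)$ are the piecewise polynomials of total degree at most $k$ on the cells and on the faces, and $\Pi^k_{\mathcal M}$, $\Pi^k_S$ are the $L^2$ projections onto polynomials of degree at most $k$ on the cells and on $S$. Let $$V(\mathcal M)=P_{k+1}(\mathcal M;\mathbb R^m)\times P_k(\Sigma;\mathbb R^m),\qquad W(\mathcal M)=P_k(\mathcal M;\mathbb M)\times P_k(\Sigma;\mathbb R^m),$$ $V_{\rm D}(\mathcal M)=\{v_h=(v_{\mathcal M},v_\Sigma)\in V(\mathcal M): v_S=0\text{ for all }S\in\Sigma_{\rm D}\}$ and $W_{\rm N}(\mathcal M)=\{\tau_h=(\tau_{\mathcal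 M},\tau_\Sigma)\in W(\mathcal M):\tau_S=0\text{ for all }S\in\Sigma_{\rm N}\}$. *Reconstructions.* $\mathrm D_hv_h\in P_k(\mathcal M;\mathbb M)$ and $\operatorname{div}_h\tau_h\in P_k(\mathcal M;\mathbb R^m)$ are the unique solutions of $$\int_\Omega \mathrm D_hv_h:\tau_k\,dx=-\int_\Omega v_{\mathcal M}\cdot\operatorname{div}_{\rm pw}\tau_k\,dx+\sum_{S\in\Sigma}\int_Sv_S\cdot[\tau_k\nu_S]_S\,ds\quad\text{for all }\tau_k\in P_k(\mathcal M;\mathbb M),$$ $$\int_\Omega\operatorname{div}_h\tau_h\cdot\varphi_k\,dx=-\int_\Omega \mathrm D_{\rm pw}\varphi_k:\tau_{\mathcal M}\,dx+\sum_{S\in\Sigma}\int_S[\varphi_k]_S\cdot\tau_S\,ds\quad\text{for all }\varphi_k\in P_k(\mathcal M;\mathbb R^m).$$ Let $Z(\mathcal M)$ be the $L^2$ orthogonal complement of $\mathrm D_{\rm pw}P_{k+1}(\mathcal M;\mathbb R^m)$ in $P_k(\mathcal M;\mathbb M)$. $\mathcal R_h^*\tau_h$ is the unique element of $P_k(\mathcal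 M;\mathbb M)$ such that $\mathcal R_h^*\tau_h$ and $\tau_{\mathcal M}$ have the same $L^2$ projection onto $Z(\mathcal M)$ and $$\int_\Omega\mathcal R_h^*\tau_h:\mathrm D_{\rm pw}v_{k+1}\,dx=-\int_\Omega v_{k+1}\cdot\operatorname{div}_h\tau_h\,dx+\sum_{S\in\Sigma}\int_S[v_{k+1}]_S\cdot\tau_S\,ds\quad\text{for all }v_{k+1}\in P_{k+1}(\mathcal M;\mathbb R^m).$$ *Stabilizations.* Let $1<r<\infty$, $r'=r/(r-1)$, $s\in\mathbb R$, and let $\mathrm s_h(v_h)=\mathrm s_h(v_h;v_h)$, where $$\mathrm s_h(u_h;v_h)=\sum_{K\in\mathcal M}\sum_{S\in\Sigma(K)}h_S^{-s}\int_S\Pi_S^k\big(|u_S-\Pi_S^ku_K|^{r-2}(u_S-\Pi_S^ku_K)\big)\cdot(v_S-\Pi_S^kv_K)\,ds,$$ $$\gamma_h(\tau_h)=\sum_{K\in\mathcal M}\sum_{S\in\Sigma(K)}h_S^{s/(r-1)}\,\|\tau_S-(\mathcal R_h^*\tau_h)|_K\nu_S\|_{L^{r'}(S)}^{r'}.$$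 *Energies.* Let $\Psi:\mathbb M\to\mathbb R\cup\{+\infty\}$ be proper, lower semicontinuous and convex, and let $\psi_h:\Omega\times\mathbb R^m\to\mathbb R\cup\{+\infty\}$ be measurable (for the product of the Lebesgue $\sigma$-algebra on $\Omega$ and the Borel $\sigma$-algebra on $\mathbb R^m$), with $\psi_h(x,\cdot)$ proper, lower semicontinuous and convex for a.e. $x\in\Omega$. A star denotes the convex conjugate (in the second variable for $\psi_h$). Put $$E_h(v_h)=\int_\Omega\big(\Psi(\mathrm D_hv_h)+\psi_h(x,\Pi_{\mathcal M}^kv_{\mathcal M})\big)\,dx+\tfrac1r\,\mathrm s_h(v_h),$$ $$E_h^*(\tau_h)=-\int_\Omega\big(\Psi^*(\mathcal R_h^*\tau_h)+\psi_h^*(x,\operatorname{div}_h\tau_h)\big)\,dx-\tfrac1{r'}\,\gamma_h(\tau_h),$$ where an integral equals $+\infty$ whenever the positive part of its integrand has infinite integral. Then, in $[-\infty,+\infty]$, $$\sup_{\tau_h\in W_{\rm N}(\mathcal M)}E_h^*(\tau_h)\;\le\;\inf_{v_h\in V_{\rm D}(\mathcal M)}E_h(v_h),$$ that is, $\max E_h^*(W_{\rm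 N}(\mathcal M))\le\min E_h(V_{\rm D}(\mathcal M))$ whenever the maximum and the minimum are attained. -/

import Mathlib

open MeasureTheory

namespace HHO

noncomputable section

/-- Points of `ℝⁿ`, with the Euclidean norm. -/
abbrev Vec (n : ℕ) : Type := EuclideanSpace ℝ (Fin n)

/-- Matrices in `ℝ^{m × n}`; the inner product is the Frobenius product `A : B`. -/
abbrev Mat (m n : ℕ) : Type := EuclideanSpace ℝ (Fin m × Fin n)

/-- Matrix times vector, `A ν`. -/
def mulVec {m n : ℕ} (A : Mat m n) (ν : Vec n) : Vec m :=
  WithLp.toLp 2 fun i => ∑ j, A (i, j) * ν j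

/-- The Jacobian matrix `(D v(x))_{ij} = ∂_j v_i(x)`. -/
def jac {m n : ℕ} (v : Vec n → Vec m) (x : Vec n) : Mat m n :=
  WithLp.toLp 2 fun ij => fderiv ℝ v x (EuclideanSpace.single ij.2 1) ij.1

/-- The row-wise divergence `(div τ(x))_i = ∑_j ∂_j τ_{ij}(x)`. -/
def dvg {m n : ℕ} (τ : Vec n → Mat m n) (x : Vec n) : Vec m :=
  WithLp.toLp 2 fun i => ∑ j, fderiv ℝ τ x (EuclideanSpace.single j 1) (i, j)

/-! ### Convex analysis -/

/-- Proper, lower semicontinuous, convex functions with values in `ℝ ∪ {+∞}`;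
convexity is convexity of the epigraph. -/
structure IsProperConvexLSC {X : Type*} [NormedAddCommGroup X] [NormedSpace ℝ X]
    (φ : X → EReal) : Prop where
  ne_bot : ∀ a, φ a ≠ ⊥
  exists_ne_top : ∃ a, φ a ≠ ⊤
  lsc : LowerSemicontinuous φ
  convex : Convex ℝ {q : X × ℝ | φ q.1 ≤ (q.2 : EReal)}

/-- The convex conjugate `φ^*(g) = sup_a (a · g - φ(a))`. -/
def conj {X : Type*} [NormedAddCommGroup X] [InnerProductSpace ℝ X]
    (φ : X → EReal) (g : X) : EReal :=
  ⨆ a : X, ((inner ℝ a g : ℝ) : EReal) - φ a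

open Classical in
/-- The integral of an extended-real-valued function: positive part minus negative part, with the
usual convention of convex analysis that it is `+∞` as soon as the positive part has infinite
integral (so `∞ - ∞ = +∞`). -/
def extIntegral {X : Type*} [MeasurableSpace X] (μ : Measure X) (f : X → EReal) : EReal :=
  if ∫⁻ x, (f x).toENNReal ∂μ = ⊤ then ⊤
  else ((∫⁻ x, (f x).toENNReal ∂μ : ENNReal) : EReal) -
    ((∫⁻ x, (-f x).toENNReal ∂μ : ENNReal) : EReal)

/-! ### Polytopal meshes -/

/-- A closed polytope in `ℝⁿ`: a finite union of nondegenerate closed `n`-simplices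
(in general not convex). -/
def IsPolytope {n : ℕ} (K : Set (Vec n)) : Prop :=
  ∃ (N : ℕ) (T : Fin N → Fin (n + 1) → Vec n),
    (∀ i, AffineIndependent ℝ (T i)) ∧ K = ⋃ i, convexHull ℝ (Set.range (T i))

/-- `S` lies in the boundary of `K`, and `ν` is the outward unit normal of `K` along `S`: near
surface-almost every `x ∈ S`, the set `K` is the half-space `{y | (y - x) · ν ≤ 0}`. -/
def HasOuterNormal {n : ℕ} (K S : Set (Vec n)) (ν : Vec n) : Prop :=
  ‖ν‖ = 1 ∧ S ⊆ frontier K ∧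
    ∀ᵐ x ∂((μHE[n - 1] : Measure (Vec n)).restrict S),
      ∃ ε > 0, ∀ y ∈ Metric.ball x ε, y ∈ K ↔ inner ℝ (y - x) ν ≤ 0

/-- A polytopal mesh of `Ω`, with cells indexed by `ι` and faces indexed by `κ`, together with the
choice of the normals `ν_S`. The cell `K_+(S)` is `plus S`; `minus S` is `some K_-(S)` for an
interior face `S`, and `none` for a boundary face `S`. Surface measure is `(n-1)`-dimensional
Hausdorff measure, normalized to agree with Lebesgue measure on hyperplanes. -/
structure Mesh (n : ℕ) (Ω : Set (Vec n)) (ι κ : Type*) where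
  cell : ι → Set (Vec n)
  face : κ → Set (Vec n)
  normal : κ → Vec n
  plus : κ → ι
  minus : κ → Option ι
  cell_polytope : ∀ K, IsPolytope (cell K)
  cell_pos : ∀ K, 0 < volume (cell K)
  cell_overlap : Pairwise fun K L => volume (cell K ∩ cell L) = 0
  cell_cover : ⋃ K, cell K = closure Ω
  face_closed : ∀ S, IsClosed (face S)
  face_connected : ∀ S, IsConnected (face S)
  face_hyperplane : ∀ S, ∃ c : ℝ, face S ⊆ {x | inner ℝ x (normal S) = c}
  face_pos : ∀ S, 0 < (μHE[n - 1] : Measure (Vec n)) (face S)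
  face_overlap : Pairwise fun S S' => (μHE[n - 1] : Measure (Vec n)) (face S ∩ face S') = 0
  face_cover : ⋃ S, face S = ⋃ K, frontier (cell K)
  plus_normal : ∀ S, HasOuterNormal (cell (plus S)) (face S) (normal S)
  minus_normal : ∀ S K, minus S = some K → HasOuterNormal (cell K) (face S) (-normal S)
  boundary : ∀ S, minus S = none → face S ⊆ frontier Ω

/-! ### Polynomials -/

/-- Vector-valued polynomial functions on `ℝⁿ` of total degree at most `k`. -/
def polySpace (n k : ℕ) (J : Type*) : Submodule ℝ (Vec n → EuclideanSpace ℝ J) where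
  carrier := {f | ∀ i, ∃ p : MvPolynomial (Fin n) ℝ, p.totalDegree ≤ k ∧
    ∀ x, f x i = MvPolynomial.eval (fun j => x j) p}
  add_mem' := by
    intro f g hf hg i
    obtain ⟨p, hp, hpf⟩ := hf i
    obtain ⟨q, hq, hqg⟩ := hg i
    refine ⟨p + q, (MvPolynomial.totalDegree_add p q).trans (max_le hp hq), fun x => ?_⟩
    simp [hpf, hqg]
  zero_mem' := fun i => ⟨0, by simp, fun x => by simp⟩
  smul_mem' := by
    intro c f hf i
    obtain ⟨p, hp, hpf⟩ := hf i
    refine ⟨c • p, (MvPolynomial.totalDegree_smul_le c p).trans hp, fun x => ?_⟩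
    simp [hpf, MvPolynomial.smul_eval]

/-- Piecewise polynomials of degree at most `k`: one polynomial for each index (a cell or a face).
The piece of index `i` stands for its restriction to the cell or face with that index, and enters
only through its values there. -/
abbrev PwPoly (I : Type*) (n k : ℕ) (J : Type*) : Type _ := I → polySpace n k J

/-- The `L²(μ)` projection of `f` onto polynomials of degree at most `k`. With `μ` the volume
measure of a cell or the surface measure of a face, it is unique as a function there. -/
def l2Proj {n : ℕ} (k : ℕ) {J : Type*} [Fintype J] (μ : Measure (Vec n))
    (f : Vec n → EuclideanSpace ℝ J) : polySpace n k J :=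
  Classical.epsilon fun p : polySpace n k J => ∀ q : polySpace n k J,
    ∫ x, inner ℝ (p.1 x) (q.1 x) ∂μ = ∫ x, inner ℝ (f x) (q.1 x) ∂μ

namespace Mesh

variable {n : ℕ} {Ω : Set (Vec n)} {ι κ : Type*} [Fintype ι] [Fintype κ] (M : Mesh n Ω ι κ)

/-- Surface measure on the face `S`. -/
def surf (S : κ) : Measure (Vec n) := (μHE[n - 1] : Measure (Vec n)).restrict (M.face S)

/-- Dirichlet faces: those contained in `Γ_D`. -/
def IsDirichlet (ΓD : Set (Vec n)) (S : κ) : Prop := M.face S ⊆ ΓD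

/-- Neumann faces: the boundary faces that are not Dirichlet faces. -/
def IsNeumann (ΓD : Set (Vec n)) (S : κ) : Prop := M.minus S = none ∧ ¬ M.IsDirichlet ΓD S

open Classical in
/-- `Σ(K)`: the faces of the cell `K`. -/
def facesOf (K : ι) : Finset κ := {S | M.face S ⊆ frontier (M.cell K)}

/-- The jump `[a]_S = a_{K_+} - a_{K_-}` on interior faces, `[a]_S = a_{K_+}` on boundary faces. -/
def jump {X : Type*} [AddGroup X] (S : κ) (a : ι → X) : X :=
  a (M.plus S) - (M.minus S).elim 0 a

/-- The function on `Ω` with the given pieces on the cells (off the null set where cells meet). -/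
def glue {k : ℕ} {J : Type*} (v : PwPoly ι n k J) (x : Vec n) : EuclideanSpace ℝ J :=
  ∑ K, (M.cell K).indicator (v K).1 x

/-- The integral over `Ω` of a cellwise defined function. -/
def cellInt (f : ι → Vec n → ℝ) : ℝ := ∑ K, ∫ x in M.cell K, f K x

/-- The sum over all faces `S` of the integrals of `f S` over `S`. -/
def faceInt (f : κ → Vec n → ℝ) : ℝ := ∑ S, ∫ x, f S x ∂(M.surf S)

end Mesh

/-- The primal ansatz space `V(M) = P_{k+1}(M; ℝᵐ) × P_k(Σ; ℝᵐ)`. -/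
abbrev PrimalSpace (ι κ : Type*) (n m k : ℕ) : Type _ :=
  PwPoly ι n (k + 1) (Fin m) × PwPoly κ n k (Fin m)

/-- The dual ansatz space `W(M) = P_k(M; ℝ^{m × n}) × P_k(Σ; ℝᵐ)`. -/
abbrev DualSpace (ι κ : Type*) (n m k : ℕ) : Type _ :=
  PwPoly ι n k (Fin m × Fin n) × PwPoly κ n k (Fin m)

namespace Mesh

variable {n m k : ℕ} {Ω : Set (Vec n)} {ι κ : Type*} [Fintype ι] [Fintype κ] (M : Mesh n Ω ι κ)

/-- `V_D(M)`: the face part vanishes on Dirichlet faces. -/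
def VD (ΓD : Set (Vec n)) : Set (PrimalSpace ι κ n m k) :=
  {v | ∀ S, M.IsDirichlet ΓD S → ∀ x ∈ M.face S, (v.2 S).1 x = 0}

/-- `W_N(M)`: the face part vanishes on Neumann faces. -/
def WN (ΓD : Set (Vec n)) : Set (DualSpace ι κ n m k) :=
  {τ | ∀ S, M.IsNeumann ΓD S → ∀ x ∈ M.face S, (τ.2 S).1 x = 0}

/-- The defining property of the gradient reconstruction of `v`. -/
def IsGradRec (v : PrimalSpace ι κ n m k) (G : PwPoly ι n k (Fin m × Fin n)) : Prop :=
  ∀ τ : PwPoly ι n k (Fin m × Fin n),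
    M.cellInt (fun K x => inner ℝ ((G K).1 x) ((τ K).1 x)) =
      - M.cellInt (fun K x => inner ℝ ((v.1 K).1 x) (dvg (τ K).1 x)) +
        M.faceInt (fun S x =>
          inner ℝ ((v.2 S).1 x) (M.jump S fun K => mulVec ((τ K).1 x) (M.normal S)))

/-- The gradient reconstruction `D_h v`. -/
def gradRec (v : PrimalSpace ι κ n m k) : PwPoly ι n k (Fin m × Fin n) :=
  Classical.epsilon fun G => M.IsGradRec v G

/-- The defining property of the divergence reconstruction of `τ`. -/
def IsDivRec (τ : DualSpace ι κ n m k) (d : PwPoly ι n k (Fin m)) : Prop :=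
  ∀ φ : PwPoly ι n k (Fin m),
    M.cellInt (fun K x => inner ℝ ((d K).1 x) ((φ K).1 x)) =
      - M.cellInt (fun K x => inner ℝ (jac (φ K).1 x) ((τ.1 K).1 x)) +
        M.faceInt (fun S x => inner ℝ (M.jump S fun K => (φ K).1 x) ((τ.2 S).1 x))

/-- The divergence reconstruction `div_h τ`. -/
def divRec (τ : DualSpace ι κ n m k) : PwPoly ι n k (Fin m) :=
  Classical.epsilon fun d => M.IsDivRec τ d

/-- `Z(M)`: the `L²` orthogonal complement of `D_pw P_{k+1}(M; ℝᵐ)` in `P_k(M; ℝ^{m × n})`. -/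
def Z : Set (PwPoly ι n k (Fin m × Fin n)) :=
  {z | ∀ w : PwPoly ι n (k + 1) (Fin m),
    M.cellInt (fun K x => inner ℝ ((z K).1 x) (jac (w K).1 x)) = 0}

/-- The defining properties of the dual potential reconstruction of `τ`. The second one says that
`R` and the cell part of `τ` have the same `L²` projection onto `Z(M)`. -/
def IsDualPotRec (τ : DualSpace ι κ n m k) (R : PwPoly ι n k (Fin m × Fin n)) : Prop :=
  (∀ w : PwPoly ι n (k + 1) (Fin m),
    M.cellInt (fun K x => inner ℝ ((R K).1 x) (jac (w K).1 x)) =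
      - M.cellInt (fun K x => inner ℝ ((w K).1 x) ((M.divRec τ K).1 x)) +
        M.faceInt (fun S x => inner ℝ (M.jump S fun K => (w K).1 x) ((τ.2 S).1 x))) ∧
  ∀ z ∈ M.Z (m := m) (k := k),
    M.cellInt (fun K x => inner ℝ ((R K).1 x) ((z K).1 x)) =
      M.cellInt (fun K x => inner ℝ ((τ.1 K).1 x) ((z K).1 x))

/-- The dual potential reconstruction `R_h^* τ`. -/
def dualPotRec (τ : DualSpace ι κ n m k) : PwPoly ι n k (Fin m × Fin n) :=
  Classical.epsilon fun R => M.IsDualPotRec τ R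

/-- The cellwise `L²` projection of the cell part of `v` onto piecewise polynomials of
degree at most `k`. -/
def cellProj (v : PrimalSpace ι κ n m k) : PwPoly ι n k (Fin m) :=
  fun K => l2Proj k (volume.restrict (M.cell K)) (v.1 K).1

/-- The difference `v_S - Π_S^k v_K` on the face `S` of the cell `K`. -/
def faceDiff (v : PrimalSpace ι κ n m k) (K : ι) (S : κ) (x : Vec n) : Vec m :=
  (v.2 S).1 x - (l2Proj k (M.surf S) (v.1 K).1).1 x

/-- `T_{K,S} u = Π_S^k (|u_S - Π_S^k u_K|^{r-2} (u_S - Π_S^k u_K))`. -/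
def traceOp (r : ℝ) (u : PrimalSpace ι κ n m k) (K : ι) (S : κ) : polySpace n k (Fin m) :=
  l2Proj k (M.surf S) fun x => ‖M.faceDiff u K S x‖ ^ (r - 2) • M.faceDiff u K S x

/-- The nonlinear Lehrenfeld-Schöberl stabilization `s_h(u; v)`. -/
def stab (r s : ℝ) (u v : PrimalSpace ι κ n m k) : ℝ :=
  ∑ K, ∑ S ∈ M.facesOf K, Metric.diam (M.face S) ^ (-s) *
    ∫ x, inner ℝ ((M.traceOp r u K S).1 x) (M.faceDiff v K S x) ∂(M.surf S)

/-- The dual stabilization: the sum over `K` and `S ∈ Σ(K)` of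
`h_S^{s/(r-1)} ‖τ_S - (R_h^* τ)|_K ν_S‖_{L^{r'}(S)}^{r'}`, where `r' = r/(r-1)`. -/
def dualStab (r s : ℝ) (τ : DualSpace ι κ n m k) : ℝ :=
  ∑ K, ∑ S ∈ M.facesOf K, Metric.diam (M.face S) ^ (s / (r - 1)) *
    ∫ x, ‖(τ.2 S).1 x - mulVec ((M.dualPotRec τ K).1 x) (M.normal S)‖ ^ (r / (r - 1)) ∂(M.surf S)

/-- The discrete primal energy
`E_h(v) = ∫_Ω (Ψ(D_h v) + ψ_h(x, Π_M^k v_M)) dx + s_h(v; v) / r`. -/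
def primalEnergy (Ψ : Mat m n → EReal) (ψ : Vec n → Vec m → EReal) (r s : ℝ)
    (v : PrimalSpace ι κ n m k) : EReal :=
  extIntegral (volume.restrict Ω)
      (fun x => Ψ (M.glue (M.gradRec v) x) + ψ x (M.glue (M.cellProj v) x)) +
    ((M.stab r s v v / r : ℝ) : EReal)

/-- The discrete dual energy
`E_h^*(τ) = -∫_Ω (Ψ^*(R_h^* τ) + ψ_h^*(x, div_h τ)) dx - γ_h(τ) / r'`, where `r' = r/(r-1)`. -/
def dualEnergy (Ψ : Mat m n → EReal) (ψ : Vec n → Vec m → EReal) (r s : ℝ)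
    (τ : DualSpace ι κ n m k) : EReal :=
  - extIntegral (volume.restrict Ω)
      (fun x => conj Ψ (M.glue (M.dualPotRec τ) x) + conj (ψ x) (M.glue (M.divRec τ) x)) -
    ((M.dualStab r s τ / (r / (r - 1)) : ℝ) : EReal)

end Mesh

end

end HHO

/-! Fix admissible `v` and `τ`, and write R for R_h^* τ. Pointwise Fenchel-Young for Ψ and for
ψ_h(x, ·) bounds the sum of the primal and dual densities from below by D_h v : R + Π^k v · div_h τ.
It therefore suffices that the integral of this product is at least -s_h(v)/r - γ_h(τ)/r'.

This integral is a pure face term (`reconstruction_pairing`). Testing D_h v with R, integrating by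
parts on each cell, and testing R with v_M cancels all volume terms. What remains on a face S is
minus the integral of the jump of (v_S - Π_S^k v_K) · (τ_S - R_K ν_S). The product v_S · τ_S that
completes this factorization is single valued, so it has no jump on an interior face; on a boundary
face it vanishes, because the face is either Dirichlet or Neumann. The projection Π_S^k comes for
free, since the flux residual is a polynomial of degree at most k. Young's inequality with powers of
h_S as weights (`weighted_young`) then bounds the face term by the two stabilizations.

The formula rests on Gauss-Green for cells that need not be convex and are known only through their
faces (`integral_cell_fderiv`). Off a set of surface measure zero, a boundary point of a cell lies
in exactly one face and the cell is locally a half-space there (`exists_null_boundary_regular`).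
Hence almost every line parallel to a coordinate axis cuts the cell in a compact set with finitely
many half-line ends, where `integral_deriv_of_locally_halfline` applies. Fubini and a change of
variables with Jacobian |ν_j| turn the endpoint values into surface integrals.

The reconstructions and projections are picked by `Classical.epsilon`, so their defining identities
hold only once solvability is known; this is finite-dimensional duality (`exists_of_bilin`). The
passage from the pointwise inequality to the energies, with all infinite cases, is
`neg_extIntegral_sub_le`. -/

namespace HHO

open Filter Topology Set

/-! ### The fundamental theorem of calculus on compact subsets of the line -/

section OneDim

/-- The step function of height `σ = ±1` at `p`, with value `0` at `p` if `σ = 1`, and `-1` otherwise. -/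
noncomputable def signedStep (σ p u : ℝ) : ℝ :=
  if σ = 1 then (if p < u then 1 else 0) else (if p ≤ u then -1 else 0)

theorem signedStep_eventually_eq_of_ne {σ p x : ℝ} (h : p ≠ x) :
    ∀ᶠ u in 𝓝 x, signedStep σ p u = signedStep σ p x := by
  rcases lt_or_gt_of_ne h with h | h
  · filter_upwards [lt_mem_nhds h] with u hu
    simp [signedStep, h, hu, h.le, hu.le]
  · filter_upwards [gt_mem_nhds h] with u hu
    simp [signedStep, not_lt.2 h.le, not_lt.2 hu.le, not_le.2 h, not_le.2 hu]

theorem integral_signedStep_mul_deriv {σ p a b : ℝ} (hσ : σ = 1 ∨ σ = -1) (ha : a < p) (hb : p < b)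
    {g g' : ℝ → ℝ} (hg : ∀ t, HasDerivAt g (g' t) t) (hg' : Continuous g') :
    IntervalIntegrable (fun u => signedStep σ p u * g' u) volume a b ∧
    ∫ u in a..b, signedStep σ p u * g' u = σ * (g b - g p) := by
  have e1 : ∀ u ∈ Ioo a p, signedStep σ p u * g' u = 0 := by
    intro u hu
    simp [signedStep, not_lt.2 hu.2.le, not_le.2 hu.2]
  have e2 : ∀ u ∈ Ioo p b, signedStep σ p u * g' u = σ * g' u := by
    intro u hu
    rcases hσ with rfl | rfl <;> simp [signedStep, hu.1, hu.1.le]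
    intro h; norm_num at h
  have i1 : IntervalIntegrable (fun u => signedStep σ p u * g' u) volume a p := by
    refine (intervalIntegrable_congr_uIoo (g := fun _ => (0:ℝ)) ?_).2 (by simp)
    rw [uIoo_of_le ha.le]; exact e1
  have i2 : IntervalIntegrable (fun u => signedStep σ p u * g' u) volume p b := by
    refine (intervalIntegrable_congr_uIoo (g := fun u => σ * g' u) ?_).2
      ((continuous_const.mul hg').intervalIntegrable _ _)
    rw [uIoo_of_le hb.le]; exact e2
  refine ⟨i1.trans i2, ?_⟩
  rw [← intervalIntegral.integral_add_adjacent_intervals i1 i2,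
    intervalIntegral.integral_congr_uIoo (g := fun _ => (0:ℝ)),
    intervalIntegral.integral_congr_uIoo (a := p) (g := fun u => σ * g' u)]
  · rw [intervalIntegral.integral_const_mul, intervalIntegral.integral_eq_sub_of_hasDerivAt
      (fun t _ => hg t) (hg'.intervalIntegrable _ _)]
    simp
  · rw [uIoo_of_le hb.le]; exact e2
  · rw [uIoo_of_le ha.le]; exact e1

/-- The fundamental theorem of calculus on a compact subset of the line which is a half-line near
each of finitely many points that contain its frontier. -/
theorem integral_deriv_of_locally_halfline {α : Type*} {A : Set ℝ} (hA : IsCompact A) (I : Finset α)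
    (p σ : α → ℝ) (hp : Set.InjOn p I) (hσ : ∀ i ∈ I, σ i = 1 ∨ σ i = -1)
    (hloc : ∀ i ∈ I, ∀ᶠ u in 𝓝 (p i), u ∈ A ↔ σ i * (u - p i) ≤ 0)
    (hfr : frontier A ⊆ p '' I) {g g' : ℝ → ℝ} (hg : ∀ t, HasDerivAt g (g' t) t)
    (hg' : Continuous g') :
    ∫ t in A, g' t = ∑ i ∈ I, σ i * g (p i) := by
  classical
  -- Each step cancels the jump of the indicator at its point; the values of the steps at the points
  -- are chosen to match the closedness of `A`. So `h` is locally constant, hence zero, since it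
  -- vanishes far to the left. The indicator is then minus a sum of steps, against which g'
  -- integrates explicitly.
  set h : ℝ → ℝ := fun u => A.indicator 1 u + ∑ i ∈ I, signedStep (σ i) (p i) u with hdef
  have hlc : IsLocallyConstant h := by
    rw [IsLocallyConstant.iff_eventually_eq]
    intro x
    by_cases hx : x ∈ p '' I
    · obtain ⟨i, hi, rfl⟩ := hx
      have hrest : ∀ᶠ u in 𝓝 (p i), ∀ j ∈ I.erase i,
          signedStep (σ j) (p j) u = signedStep (σ j) (p j) (p i) := by
        rw [Filter.eventually_all_finset]
        intro j hj
        apply signedStep_eventually_eq_of_ne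
        intro hji
        exact (Finset.mem_erase.1 hj).1 (hp (Finset.mem_erase.1 hj).2 hi hji)
      filter_upwards [hrest, hloc i hi] with u hu huA
      have hpA := (hloc i hi).self_of_nhds
      simp only [hdef]
      rw [← Finset.add_sum_erase _ _ (Finset.mem_coe.1 hi),
        ← Finset.add_sum_erase _ _ (Finset.mem_coe.1 hi), Finset.sum_congr rfl hu, ← add_assoc, ← add_assoc]
      congr 1
      have hpA' : p i ∈ A := hpA.2 (by simp)
      rcases hσ i hi with h1 | h1
      · rw [h1] at huA
        by_cases hup : p i < u
        · have : u ∉ A := fun hh => by have := huA.1 hh; linarith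
          simp [signedStep, h1, hup, this, hpA']
        · have : u ∈ A := huA.2 (by linarith [not_lt.1 hup])
          simp [signedStep, h1, hup, this, hpA']
      · rw [h1] at huA
        have h11 : ¬ ((-1:ℝ) = 1) := by norm_num
        by_cases hup : p i ≤ u
        · have : u ∈ A := huA.2 (by linarith)
          simp [signedStep, h1, hup, this, hpA', h11]
        · have : u ∉ A := fun hh => by have := huA.1 hh; linarith [not_le.1 hup]
          simp [signedStep, h1, hup, this, hpA', h11]
    · have hrest : ∀ᶠ u in 𝓝 x, ∀ j ∈ I,
          signedStep (σ j) (p j) u = signedStep (σ j) (p j) x := by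
        rw [Filter.eventually_all_finset]
        intro j hj
        exact signedStep_eventually_eq_of_ne fun hji => hx ⟨j, hj, hji⟩
      have hxA : ∀ᶠ u in 𝓝 x, A.indicator (1 : ℝ → ℝ) u = A.indicator 1 x := by
        have hxf : x ∉ frontier A := fun hh => hx (hfr hh)
        by_cases hxA : x ∈ A
        · have : x ∈ interior A := by
            by_contra hi; exact hxf ⟨subset_closure hxA, hi⟩
          filter_upwards [mem_interior_iff_mem_nhds.1 this] with u hu
          simp [hu, hxA]
        · filter_upwards [hA.isClosed.isOpen_compl.mem_nhds hxA] with u hu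
          have hu' : u ∉ A := hu
          simp [hu', hxA]
      filter_upwards [hrest, hxA] with u h1 h2
      simp only [hdef]
      rw [h2, Finset.sum_congr rfl h1]
  obtain ⟨a, ha⟩ := hA.bddBelow
  obtain ⟨b, hb⟩ := hA.bddAbove
  obtain ⟨a', ha'⟩ := (I.image p).bddBelow
  obtain ⟨b', hb'⟩ := (I.image p).bddAbove
  set a₀ := min a a' - 1
  -- The maximum with `a₀` keeps `a₀ < b₀` when `A` and `I` are empty and their bounds are
  -- arbitrary.
  set b₀ := max (max b b') a₀ + 1
  have hab : a₀ < b₀ := by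
    have := le_max_right (max b b') a₀; linarith
  have hIa : ∀ i ∈ I, a₀ < p i := fun i hi => by
    have h1 : a' ≤ p i := ha' (by simpa using ⟨i, hi, rfl⟩)
    have := min_le_right a a'; simp only [a₀]; linarith
  have hIb : ∀ i ∈ I, p i < b₀ := fun i hi => by
    have h1 : p i ≤ b' := hb' (by simpa using ⟨i, hi, rfl⟩)
    have := le_max_left (max b b') a₀; have := le_max_right b b'; simp only [b₀]; linarith
  have hAa : ∀ t ∈ A, a₀ < t := fun t ht => by
    have := ha ht; have := min_le_left a a'; simp only [a₀]; linarith
  have hAb : ∀ t ∈ A, t < b₀ := fun t ht => by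
    have := hb ht
    have := le_max_left (max b b') a₀; have := le_max_left b b'; simp only [b₀]; linarith
  have ha₀ : h a₀ = 0 := by
    have : a₀ ∉ A := fun hh => lt_irrefl _ (hAa _ hh)
    simp only [hdef, this, not_false_eq_true, indicator_of_notMem, zero_add]
    refine Finset.sum_eq_zero fun i hi => ?_
    simp [signedStep, not_lt.2 (hIa i hi).le, not_le.2 (hIa i hi)]
  have hz : ∀ u, h u = 0 := fun u => by
    rw [hlc.apply_eq_of_preconnectedSpace u a₀, ha₀]
  -- To the right of everything the i-th step equals `σ i`, so `h b₀ = 0` says that the signs add up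
  -- to zero. This removes the term `g b₀` at the end.
  have hsum : ∑ i ∈ I, σ i = 0 := by
    have : b₀ ∉ A := fun hh => lt_irrefl _ (hAb _ hh)
    have hb₀ := hz b₀
    simp only [hdef, this, not_false_eq_true, indicator_of_notMem, zero_add] at hb₀
    rw [← hb₀]
    refine Finset.sum_congr rfl fun i hi => ?_
    have h11 : ¬ ((-1:ℝ) = 1) := by norm_num
    rcases hσ i hi with h1 | h1 <;> simp [signedStep, h1, hIb i hi, (hIb i hi).le, h11]
  have hind : ∀ u, A.indicator g' u = - ∑ i ∈ I, signedStep (σ i) (p i) u * g' u := by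
    intro u
    have := hz u
    simp only [hdef] at this
    rw [← Finset.sum_mul, eq_neg_of_add_eq_zero_right this]
    by_cases hu : u ∈ A <;> simp [hu]
  have hsub : A ⊆ Ioc a₀ b₀ := fun t ht => ⟨hAa t ht, (hAb t ht).le⟩
  have hmeas := hA.isClosed.measurableSet
  calc ∫ t in A, g' t = ∫ t in Ioc a₀ b₀, A.indicator g' t := by
        rw [setIntegral_indicator hmeas, inter_eq_self_of_subset_right hsub]
    _ = ∫ t in a₀..b₀, A.indicator g' t := by rw [intervalIntegral.integral_of_le hab.le]
    _ = - ∑ i ∈ I, ∫ t in a₀..b₀, signedStep (σ i) (p i) t * g' t := by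
        simp_rw [hind]
        rw [intervalIntegral.integral_neg, intervalIntegral.integral_finsetSum]
        exact fun i hi => (integral_signedStep_mul_deriv (hσ i hi) (hIa i hi) (hIb i hi) hg hg').1
    _ = - ∑ i ∈ I, σ i * (g b₀ - g (p i)) := by
        congr 1
        exact Finset.sum_congr rfl fun i hi =>
          (integral_signedStep_mul_deriv (hσ i hi) (hIa i hi) (hIb i hi) hg hg').2
    _ = ∑ i ∈ I, σ i * g (p i) := by
        simp_rw [mul_sub, Finset.sum_sub_distrib, ← Finset.sum_mul, hsum]
        ring

end OneDim

/-! ### Charts of hyperplanes, coordinate projections and surface measure -/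

section Chart

variable {d : ℕ}

/-- Deletion of the `j`-th coordinate. -/
noncomputable def dropCoord (j : Fin (d + 1)) : Vec (d + 1) →ₗ[ℝ] Vec d where
  toFun x := WithLp.toLp 2 fun i => x (j.succAbove i)
  map_add' _ _ := rfl
  map_smul' _ _ := rfl

@[simp] theorem dropCoord_apply (j : Fin (d + 1)) (x : Vec (d + 1)) (i : Fin d) :
    dropCoord j x i = x (j.succAbove i) := rfl

/-- Insertion of a `j`-th coordinate. -/
noncomputable def insCoord (j : Fin (d + 1)) (t : ℝ) (y : Vec d) : Vec (d + 1) :=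
  WithLp.toLp 2 (j.insertNth t y)

@[simp] theorem insCoord_apply_same (j : Fin (d + 1)) (t : ℝ) (y : Vec d) :
    insCoord j t y j = t := by simp [insCoord]

@[simp] theorem insCoord_apply_succAbove (j : Fin (d + 1)) (t : ℝ) (y : Vec d) (i : Fin d) :
    insCoord j t y (j.succAbove i) = y i := by simp [insCoord]

@[simp] theorem dropCoord_insCoord (j : Fin (d + 1)) (t : ℝ) (y : Vec d) :
    dropCoord j (insCoord j t y) = y := by ext i; simp

@[simp] theorem insCoord_dropCoord (j : Fin (d + 1)) (x : Vec (d + 1)) :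
    insCoord j (x j) (dropCoord j x) = x := by
  ext i
  rcases Fin.eq_self_or_eq_succAbove j i with rfl | ⟨i, rfl⟩ <;> simp

theorem inner_insCoord (j : Fin (d + 1)) (t : ℝ) (y : Vec d) (ν : Vec (d + 1)) :
    inner ℝ (insCoord j t y) ν = t * ν j + inner ℝ y (dropCoord j ν) := by
  simp [PiLp.inner_apply, Fin.sum_univ_succAbove _ j, mul_comm]

theorem norm_dropCoord_le (j : Fin (d + 1)) (x : Vec (d + 1)) : ‖dropCoord j x‖ ≤ ‖x‖ := by
  rw [EuclideanSpace.norm_eq, EuclideanSpace.norm_eq]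
  apply Real.sqrt_le_sqrt
  rw [Fin.sum_univ_succAbove _ j]
  simp only [dropCoord_apply]
  nlinarith [sq_nonneg ‖x j‖]

/-- An isometric parametrization of the hyperplane `ν^⊥`, together with the Jacobians of the
coordinate projections. -/
theorem exists_chart {ν : Vec (d + 1)} (hν : ‖ν‖ = 1) :
    ∃ L : Vec d →ₗᵢ[ℝ] Vec (d + 1), (∀ y, inner ℝ (L y) ν = 0) ∧
      (∀ x, inner ℝ x ν = 0 → ∃ y, L y = x) ∧
      ∀ j, |LinearMap.det (dropCoord j ∘ₗ L.toLinearMap)| = |ν j| := by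
  obtain ⟨b, hb⟩ := Orthonormal.exists_orthonormalBasis_extension_of_card_eq
    (𝕜 := ℝ) (E := Vec (d + 1)) (ι := Fin (d + 1)) (by simp) (v := fun _ => ν) (s := {0})
    (by
      rw [orthonormal_iff_ite]
      rintro ⟨i, hi⟩ ⟨j, hj⟩
      have hi' : i = 0 := hi
      have hj' : j = 0 := hj
      subst hi' hj'
      simp [hν])
  have hb0 : b 0 = ν := hb 0 rfl
  let c : Vec d →ₗ[ℝ] Vec (d + 1) :=
    { toFun := fun y => insCoord 0 0 y
      map_add' := by
        intro x y; ext i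
        refine Fin.cases ?_ (fun i => ?_) i <;> simp [insCoord]
      map_smul' := by
        intro a y; ext i
        refine Fin.cases ?_ (fun i => ?_) i <;> simp [insCoord] }
  have hcn : ∀ y, ‖c y‖ = ‖y‖ := by
    intro y
    rw [EuclideanSpace.norm_eq, EuclideanSpace.norm_eq, Fin.sum_univ_succ]
    simp [c, insCoord]
  let L : Vec d →ₗᵢ[ℝ] Vec (d + 1) :=
    { toLinearMap := b.repr.symm.toLinearEquiv.toLinearMap ∘ₗ c
      norm_map' := fun y => by simp [hcn] }
  have hL : ∀ y, L y = b.repr.symm (c y) := fun y => rfl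
  refine ⟨L, ?_, ?_, ?_⟩
  · intro y
    rw [hL, real_inner_comm, ← hb0, ← b.repr_apply_apply]
    simp [c, insCoord]
  · intro x hx
    refine ⟨dropCoord 0 (b.repr x), ?_⟩
    rw [hL, LinearIsometryEquiv.symm_apply_eq]
    have h0 : (b.repr x) 0 = 0 := by rw [b.repr_apply_apply, hb0, real_inner_comm, hx]
    have := insCoord_dropCoord 0 (b.repr x)
    rw [h0] at this
    exact this
  · intro j
    -- In coordinates, `dropCoord j ∘ L` is `O` with row j and column 0 deleted. Its determinant is,
    -- up to sign, the entry (0, j) of the adjugate; orthogonality gives adj O = det O · Oᵀ with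
    -- |det O| = 1, and column 0 of `O` is ν.
    let O : Matrix (Fin (d + 1)) (Fin (d + 1)) ℝ := Matrix.of fun i a => b a i
    have hO : O.transpose * O = 1 := by
      ext a a'
      have := (orthonormal_iff_ite.1 b.orthonormal) a a'
      simp only [Matrix.mul_apply, Matrix.transpose_apply, Matrix.one_apply, O, Matrix.of_apply]
      rw [← this, PiLp.inner_apply]
      simp [mul_comm]
    have hdet : |O.det| = 1 := by
      have h1 := congrArg Matrix.det hO
      rw [Matrix.det_mul, Matrix.det_transpose, Matrix.det_one] at h1
      rcases mul_self_eq_one_iff.1 h1 with h | h <;> simp [h]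
    have hadj : O.adjugate = O.det • O.transpose := by
      calc O.adjugate = (O.transpose * O) * O.adjugate := by rw [hO, one_mul]
        _ = O.det • O.transpose := by rw [mul_assoc, Matrix.mul_adjugate]; simp
    have h2 := Matrix.adjugate_fin_succ_eq_det_submatrix O 0 j
    rw [hadj] at h2
    have hmat : LinearMap.toMatrix (EuclideanSpace.basisFun (Fin d) ℝ).toBasis
        (EuclideanSpace.basisFun (Fin d) ℝ).toBasis (dropCoord j ∘ₗ L.toLinearMap) =
        O.submatrix j.succAbove (0 : Fin (d + 1)).succAbove := by
      ext i a
      rw [LinearMap.toMatrix_apply]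
      have hca : c (EuclideanSpace.single a 1) = EuclideanSpace.single a.succ 1 := by
        ext i
        refine Fin.cases ?_ (fun i => ?_) i <;> simp [c, insCoord, Pi.single_apply]
      have : L (EuclideanSpace.single a 1) = b a.succ := by
        rw [hL, hca, b.repr_symm_single]
      simp [this, O]
    rw [← LinearMap.det_toMatrix (EuclideanSpace.basisFun (Fin d) ℝ).toBasis, hmat]
    have h3 := congrArg abs h2
    simp only [Matrix.smul_apply, Matrix.transpose_apply, O, Matrix.of_apply, smul_eq_mul,
      abs_mul, hb0] at h3
    rw [hdet] at h3
    simpa using h3.symm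

theorem volume_level_eq_zero {v : Vec d} (hv : v ≠ 0) (c : ℝ) :
    volume {y : Vec d | inner ℝ y v = c} = 0 := by
  rcases Set.eq_empty_or_nonempty {y : Vec d | inner ℝ y v = c} with h | ⟨p, hp⟩
  · simp [h]
  · have h1 : {y : Vec d | inner ℝ y v = c} =
        (fun y => y - p) ⁻¹' ((LinearMap.ker (innerSL ℝ v).toLinearMap : Submodule ℝ (Vec d)) :
          Set (Vec d)) := by
      ext y
      have hp' : inner ℝ p v = c := hp
      simp [real_inner_comm, inner_sub_right, sub_eq_zero]
      rw [real_inner_comm p v, hp']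
    simp_rw [h1, sub_eq_add_neg]
    rw [measure_preimage_add_right]
    apply Measure.addHaar_submodule
    intro htop
    have : v ∈ LinearMap.ker (innerSL ℝ v).toLinearMap := htop ▸ Submodule.mem_top
    simp at this
    exact hv this

/-- Isometric charts of affine hyperplanes. -/
theorem exists_affine_chart {ν : Vec (d + 1)} (hν : ‖ν‖ = 1) (c : ℝ) :
    ∃ (b : Vec (d + 1)) (L : Vec d →ₗᵢ[ℝ] Vec (d + 1)),
      Set.range (fun y => b + L y) = {x | inner ℝ x ν = c} ∧
      ∀ j, |LinearMap.det (dropCoord j ∘ₗ L.toLinearMap)| = |ν j| := by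
  obtain ⟨L, h1, h2, h3⟩ := exists_chart hν
  refine ⟨c • ν, L, ?_, h3⟩
  ext x
  constructor
  · rintro ⟨y, rfl⟩
    simp [inner_add_left, h1, inner_smul_left, hν]
  · intro hx
    have hx' : inner ℝ x ν = c := hx
    obtain ⟨y, hy⟩ := h2 (x - c • ν) (by
      simp [inner_sub_left, inner_smul_left, hν, hx'])
    exact ⟨y, by simp [hy]⟩

theorem isometry_chart (b : Vec (d + 1)) (L : Vec d →ₗᵢ[ℝ] Vec (d + 1)) :
    Isometry fun y => b + L y :=
  (IsometryEquiv.addLeft b).isometry.comp L.isometry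

/-- Isometries preserve Hausdorff measure, which in its Euclidean normalization is Lebesgue measure
on ℝ^d. Surface integrals thereby become Lebesgue integrals in the chart. -/
theorem hausdorff_restrict_eq_map {b : Vec (d + 1)} {L : Vec d →ₗᵢ[ℝ] Vec (d + 1)}
    {S : Set (Vec (d + 1))} (hS : MeasurableSet S) (hsub : S ⊆ Set.range fun y => b + L y) :
    (μHE[d] : Measure (Vec (d + 1))).restrict S =
      ((volume : Measure (Vec d)).restrict ((fun y => b + L y) ⁻¹' S)).map (fun y => b + L y) := by
  have hi := isometry_chart b L
  have h := hi.map_euclideanHausdorffMeasure (d := d)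
  rw [EuclideanSpace.euclideanHausdorffMeasure_eq_volume] at h
  rw [← Measure.restrict_map hi.continuous.measurable hS, h, Measure.restrict_restrict hS,
    inter_eq_self_of_subset_left hsub]

theorem hausdorff_apply_of_subset_range {b : Vec (d + 1)} {L : Vec d →ₗᵢ[ℝ] Vec (d + 1)}
    {S : Set (Vec (d + 1))} (hsub : S ⊆ Set.range fun y => b + L y) :
    (μHE[d] : Measure (Vec (d + 1))) S = volume ((fun y => b + L y) ⁻¹' S) := by
  have hi := isometry_chart b L
  rw [← EuclideanSpace.euclideanHausdorffMeasure_eq_volume, hi.euclideanHausdorffMeasure_preimage,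
    inter_eq_self_of_subset_left hsub]

theorem hausdorff_lt_top_of_isBounded {ν : Vec (d + 1)} (hν : ‖ν‖ = 1) {c : ℝ}
    {S : Set (Vec (d + 1))} (hb : Bornology.IsBounded S) (hsub : S ⊆ {x | inner ℝ x ν = c}) :
    (μHE[d] : Measure (Vec (d + 1))) S < ⊤ := by
  obtain ⟨b, L, h1, -⟩ := exists_affine_chart hν c
  rw [hausdorff_apply_of_subset_range (by rwa [h1])]
  exact ((isometry_chart b L).antilipschitz.isBounded_preimage hb).measure_lt_top

/-- Coordinate projections are 1-Lipschitz and so do not increase Hausdorff measure. Consequence: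
almost every line parallel to the j-th axis misses a given surface-null set. -/
theorem volume_image_dropCoord_eq_zero (j : Fin (d + 1)) {N : Set (Vec (d + 1))}
    (hN : (μHE[d] : Measure (Vec (d + 1))) N = 0) : volume (dropCoord j '' N) = 0 := by
  have hl : LipschitzWith 1 (dropCoord (d := d) j) := by
    refine LipschitzWith.of_dist_le_mul fun x y => ?_
    rw [dist_eq_norm, dist_eq_norm, ← map_sub]
    simpa using norm_dropCoord_le j (x - y)
  rw [← EuclideanSpace.euclideanHausdorffMeasure_eq_volume]
  rw [Measure.euclideanHausdorffMeasure_def] at hN ⊢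
  have hne := Measure.addHaarScalarFactor_volume_hausdorffMeasure_ne_zero d
  have hN' : (μH[d] : Measure (Vec (d + 1))) N = 0 := by
    rw [Measure.smul_apply, smul_eq_zero] at hN
    exact hN.resolve_left hne
  have := hl.hausdorffMeasure_image_le (d := (d : ℝ)) (by positivity) N
  rw [hN'] at this
  rw [Measure.smul_apply, smul_eq_zero]
  right
  simpa using this

/-- The projection of a hyperplane along a direction which it contains is a null set. -/
theorem volume_image_dropCoord_hyperplane (j : Fin (d + 1)) {ν : Vec (d + 1)} (hν : ‖ν‖ = 1)
    (hj : ν j = 0) (c : ℝ) : volume (dropCoord j '' {x | inner ℝ x ν = c}) = 0 := by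
  have hne : dropCoord j ν ≠ 0 := by
    intro h
    have h1 := insCoord_dropCoord j ν
    rw [h, hj] at h1
    have : ν = 0 := by
      rw [← h1]; ext i
      rcases Fin.eq_self_or_eq_succAbove j i with rfl | ⟨i, rfl⟩ <;> simp
    simp [this] at hν
  refine measure_mono_null ?_ (volume_level_eq_zero hne c)
  rintro _ ⟨x, hx, rfl⟩
  have hx' : inner ℝ x ν = c := hx
  rw [← insCoord_dropCoord j x, inner_insCoord, hj] at hx'
  simpa using hx'

/-- The `j`-th coordinate of the point over `y` of the hyperplane `{x | x · ν = c}`. -/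
noncomputable def liftHeight (j : Fin (d + 1)) (ν : Vec (d + 1)) (c : ℝ) (y : Vec d) : ℝ :=
  (c - inner ℝ y (dropCoord j ν)) / ν j

theorem insCoord_liftHeight {j : Fin (d + 1)} {ν : Vec (d + 1)} (hj : ν j ≠ 0) {c : ℝ}
    {x : Vec (d + 1)} (hx : inner ℝ x ν = c) : liftHeight j ν c (dropCoord j x) = x j := by
  rw [← insCoord_dropCoord j x, inner_insCoord] at hx
  rw [liftHeight, div_eq_iff hj, ← hx]
  ring

/-- The chart of the hyperplane followed by deletion of the j-th coordinate is an injective affine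
map with Jacobian |ν_j|, and `liftHeight` inverts the projection. The right-hand side is the form in
which face terms arise from Fubini. -/
theorem integral_face_eq_integral_proj (j : Fin (d + 1)) {ν : Vec (d + 1)} (hν : ‖ν‖ = 1)
    (hj : ν j ≠ 0) {c : ℝ} {S : Set (Vec (d + 1))} (hS : IsClosed S)
    (hsub : S ⊆ {x | inner ℝ x ν = c}) (F : Vec (d + 1) → ℝ) :
    |ν j| * ∫ x, F x ∂((μHE[d] : Measure (Vec (d + 1))).restrict S) =
      ∫ y, S.indicator F (insCoord j (liftHeight j ν c y) y) := by
  obtain ⟨b, L, h1, h2⟩ := exists_affine_chart hν c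
  have hi := isometry_chart b L
  have hm : MeasurableSet ((fun y => b + L y) ⁻¹' S) := (hS.preimage hi.continuous).measurableSet
  rw [hausdorff_restrict_eq_map hS.measurableSet (by rwa [h1]),
    (hi.isClosedEmbedding.measurableEmbedding).integral_map]
  let A : Vec d →L[ℝ] Vec d := LinearMap.toContinuousLinearMap (dropCoord j ∘ₗ L.toLinearMap)
  have hdet : |A.det| = |ν j| := by
    rw [← h2 j]; rfl
  have hinj : Function.Injective A := by
    have : IsUnit (LinearMap.det (dropCoord j ∘ₗ L.toLinearMap)) := by
      rw [isUnit_iff_ne_zero]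
      intro h0
      have := h2 j
      rw [h0] at this
      exact hj (abs_eq_zero.1 (by simpa using this.symm))
    exact ((Module.End.isUnit_iff _).1 ((LinearMap.isUnit_iff_isUnit_det _).2 this)).injective
  have hAL : ∀ y, dropCoord j (b + L y) = dropCoord j b + A y := fun y => map_add _ _ _
  have hder : ∀ x ∈ (fun y => b + L y) ⁻¹' S, HasFDerivWithinAt
      (fun y => dropCoord j (b + L y)) A ((fun y => b + L y) ⁻¹' S) x := fun x _ => by
    simp_rw [hAL]
    exact (A.hasFDerivAt.const_add _).hasFDerivWithinAt
  have hinjOn : InjOn (fun y => dropCoord j (b + L y)) ((fun y => b + L y) ⁻¹' S) :=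
    fun x _ y _ hxy => by
      simp only [hAL] at hxy
      exact hinj (add_left_cancel hxy)
  have key := integral_image_eq_integral_abs_det_fderiv_smul (volume : Measure (Vec d)) hm
    hder hinjOn (fun y => F (insCoord j (liftHeight j ν c y) y))
  simp only [hdet, smul_eq_mul] at key
  rw [integral_const_mul] at key
  have hmem : ∀ y, inner ℝ (b + L y) ν = c := fun y => by
    have : b + L y ∈ Set.range fun y => b + L y := ⟨y, rfl⟩
    rw [h1] at this; exact this
  have hlift : ∀ y, insCoord j (liftHeight j ν c (dropCoord j (b + L y))) (dropCoord j (b + L y)) =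
      b + L y := fun y => by
    rw [insCoord_liftHeight hj (hmem y), insCoord_dropCoord]
  simp only [hlift] at key
  rw [← key, ← integral_indicator]
  · congr 1
    ext y
    by_cases hy : y ∈ (fun y => dropCoord j (b + L y)) '' ((fun y => b + L y) ⁻¹' S)
    · rw [Set.indicator_of_mem hy]
      obtain ⟨z, hz, rfl⟩ := hy
      simp only [hlift]
      exact (Set.indicator_of_mem (s := S) hz F).symm
    · rw [Set.indicator_of_notMem hy, Set.indicator_of_notMem]
      intro hyS
      have := hsub hyS
      rw [← h1] at this
      obtain ⟨z, hz⟩ := this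
      refine hy ⟨z, ?_, ?_⟩
      · simp only [Set.mem_preimage, hz]; exact hyS
      · simp only [hz, dropCoord_insCoord]
  · exact measurable_image_of_fderivWithin hm hder hinjOn

/-- The zero set of an affine function either contains a hyperplane or meets it in a set of
surface measure zero. -/
theorem hausdorff_hyperplane_inter_level {ν : Vec (d + 1)} (hν : ‖ν‖ = 1) (c : ℝ)
    (v : Vec (d + 1)) (a : ℝ) :
    {x | inner ℝ x ν = c} ⊆ {x : Vec (d + 1) | inner ℝ x v = a} ∨
      (μHE[d] : Measure (Vec (d + 1))) ({x | inner ℝ x ν = c} ∩ {x | inner ℝ x v = a}) = 0 := by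
  obtain ⟨b, L, h1, -⟩ := exists_affine_chart hν c
  rw [← h1]
  -- In the chart the function x · v is affine with gradient L* v. If the gradient is nonzero the
  -- level set is null; otherwise the level set is everything or empty.
  have hpre : (fun y => b + L y) ⁻¹' {x : Vec (d + 1) | inner ℝ x v = a} =
      {y | inner ℝ y (L.toContinuousLinearMap.adjoint v) = a - inner ℝ b v} := by
    ext y
    simp only [Set.mem_preimage, Set.mem_ofPred_eq, inner_add_left,
      ContinuousLinearMap.adjoint_inner_right]
    constructor
    · intro h
      have : inner ℝ (L.toContinuousLinearMap y) v = inner ℝ (L y) v := rfl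
      rw [this]; linarith
    · intro h
      have : inner ℝ (L.toContinuousLinearMap y) v = inner ℝ (L y) v := rfl
      rw [this] at h; linarith
  by_cases hv : L.toContinuousLinearMap.adjoint v = 0
  · rw [hv] at hpre
    by_cases ha : a - inner ℝ b v = 0
    · left
      rintro _ ⟨y, rfl⟩
      have : y ∈ (fun y => b + L y) ⁻¹' {x : Vec (d + 1) | inner ℝ x v = a} := by
        rw [hpre]; simp [ha]
      exact this
    · right
      rw [hausdorff_apply_of_subset_range (b := b) (L := L) inter_subset_left, preimage_inter, hpre]
      have : {y : Vec d | inner ℝ y (0 : Vec d) = a - inner ℝ b v} = ∅ := by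
        ext y; simp [Ne.symm ha]
      rw [this]; simp
  · right
    rw [hausdorff_apply_of_subset_range (b := b) (L := L) inter_subset_left, preimage_inter, hpre]
    exact measure_mono_null inter_subset_right (volume_level_eq_zero hv _)

/-- Fubini's theorem in the direction of the `j`-th coordinate axis. -/
theorem integral_eq_integral_insCoord (j : Fin (d + 1)) {F : Vec (d + 1) → ℝ} (hF : Integrable F) :
    Integrable (fun y : Vec d => ∫ t : ℝ, F (insCoord j t y)) ∧
    ∫ x, F x = ∫ y : Vec d, ∫ t : ℝ, F (insCoord j t y) := by
  let e : ℝ × Vec d ≃ᵐ Vec (d + 1) :=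
    ((MeasurableEquiv.refl ℝ).prodCongr (MeasurableEquiv.toLp 2 (Fin d → ℝ)).symm).trans
      ((MeasurableEquiv.piFinSuccAbove (fun _ => ℝ) j).symm.trans
        (MeasurableEquiv.toLp 2 (Fin (d + 1) → ℝ)))
  have he : MeasurePreserving e := by
    have h1 : MeasurePreserving ((MeasurableEquiv.refl ℝ).prodCongr
        (MeasurableEquiv.toLp 2 (Fin d → ℝ)).symm) :=
      (MeasurePreserving.id volume).prod (PiLp.volume_preserving_ofLp (Fin d))
    have h2 := (volume_preserving_piFinSuccAbove (fun _ : Fin (d + 1) => ℝ) j).symm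
    exact (PiLp.volume_preserving_toLp (Fin (d + 1))).comp (h2.comp h1)
  have hee : ∀ t y, e (t, y) = insCoord j t y := fun t y => rfl
  have hi : Integrable (fun z => F (e z)) (volume.prod volume) :=
    (he.integrable_comp_emb e.measurableEmbedding).2 hF
  have h3 := integral_prod_symm _ hi
  refine ⟨by simpa only [hee] using hi.integral_prod_right, ?_⟩
  rw [← he.integral_comp e.measurableEmbedding]
  exact h3

end Chart

/-! ### Local geometry of simplices and polytopes -/

section Polytope

variable {d : ℕ}

theorem interior_simplex_nonempty {n : ℕ} {T : Fin (n + 1) → Vec n} (hT : AffineIndependent ℝ T) :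
    (interior (convexHull ℝ (Set.range T))).Nonempty := by
  rw [interior_convexHull_nonempty_iff_affineSpan_eq_top,
    hT.affineSpan_eq_top_iff_card_eq_finrank_add_one]
  simp

theorem isCompact_simplex {n N : ℕ} (T : Fin N → Vec n) :
    IsCompact (convexHull ℝ (Set.range T)) :=
  (Set.finite_range T).isCompact_convexHull (𝕜 := ℝ)

theorem simplex_subset_closure_interior {n : ℕ} {T : Fin (n + 1) → Vec n}
    (hT : AffineIndependent ℝ T) :
    convexHull ℝ (Set.range T) ⊆ closure (interior (convexHull ℝ (Set.range T))) := by
  rw [(convex_convexHull ℝ _).closure_interior_eq_closure_of_nonempty_interior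
    (interior_simplex_nonempty hT)]
  exact subset_closure

theorem IsPolytope.isCompact {n : ℕ} {K : Set (Vec n)} (hK : IsPolytope K) : IsCompact K := by
  obtain ⟨N, T, -, rfl⟩ := hK
  exact isCompact_iUnion fun i => isCompact_simplex _

/-- Nondegenerate simplices leave no lower-dimensional pieces. Hence a polytope that reaches a point
has positive volume near it, which is how null overlaps of cells lead to contradictions. -/
theorem IsPolytope.subset_closure_interior {n : ℕ} {K : Set (Vec n)} (hK : IsPolytope K) :
    K ⊆ closure (interior K) := by
  obtain ⟨N, T, hT, rfl⟩ := hK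
  refine iUnion_subset fun i => (simplex_subset_closure_interior (hT i)).trans ?_
  exact closure_mono (interior_mono (subset_iUnion (fun i => convexHull ℝ (Set.range (T i))) i))

theorem exists_inner_repr {n : ℕ} (l : Vec n →ᵃ[ℝ] ℝ) :
    ∃ (v : Vec n) (a : ℝ), ∀ x, l x = inner ℝ x v - a := by
  refine ⟨(InnerProductSpace.toDual ℝ (Vec n)).symm (LinearMap.toContinuousLinearMap l.linear),
    - l 0, fun x => ?_⟩
  rw [real_inner_comm, InnerProductSpace.toDual_symm_apply]
  have := congrFun l.decomp x
  simp only [Pi.add_apply] at this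
  rw [this]
  simp

/-- Surface-almost everywhere on a hyperplane, a simplex which lies locally on one side of it
fills this side locally. -/
theorem simplex_fills_halfspace_ae {ν : Vec (d + 1)} (hν : ‖ν‖ = 1) (c : ℝ)
    {T : Fin (d + 1 + 1) → Vec (d + 1)} (hT : AffineIndependent ℝ T) :
    (μHE[d] : Measure (Vec (d + 1))) {x | inner ℝ x ν = c ∧ x ∈ convexHull ℝ (Set.range T) ∧
      (∀ᶠ y in 𝓝 x, y ∈ convexHull ℝ (Set.range T) → 0 ≤ inner ℝ (y - x) ν) ∧
      ¬ ∀ᶠ y in 𝓝 x, 0 ≤ inner ℝ (y - x) ν → y ∈ convexHull ℝ (Set.range T)} = 0 := by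
  let B : AffineBasis (Fin (d + 1 + 1)) ℝ (Vec (d + 1)) := ⟨T, hT, by
    rw [hT.affineSpan_eq_top_iff_card_eq_finrank_add_one]; simp⟩
  have hB : convexHull ℝ (Set.range T) = {x | ∀ i, 0 ≤ B.coord i x} :=
    B.convexHull_eq_nonneg_coord
  choose v a hva using fun i => exists_inner_repr (B.coord i)
  -- The exceptional set is where the hyperplane meets the zero set of a barycentric coordinate that
  -- does not vanish on all of it. Elsewhere each coordinate either is positive at `x` or vanishes
  -- on the whole hyperplane.
  refine measure_mono_null (t := ⋃ i : {i // ¬ {x : Vec (d + 1) | inner ℝ x ν = c} ⊆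
      {x : Vec (d + 1) | inner ℝ x (v i) = a i}},
    {x : Vec (d + 1) | inner ℝ x ν = c} ∩ {x : Vec (d + 1) | inner ℝ x (v i) = a i}) ?_
    (measure_iUnion_null fun i =>
      (hausdorff_hyperplane_inter_level hν c (v i) (a i)).resolve_left i.2)
  rintro x ⟨hxc, hxT, hside, hnot⟩
  by_contra hx
  simp only [mem_iUnion, not_exists] at hx
  apply hnot
  obtain ⟨y₀, hy₀T, hy₀⟩ : ∃ y ∈ convexHull ℝ (Set.range T), 0 < inner ℝ (y - x) ν := by
    obtain ⟨U, hU, hUo, hxU⟩ := eventually_nhds_iff.1 hside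
    obtain ⟨y, hyU, hyT⟩ := mem_closure_iff.1 (simplex_subset_closure_interior hT hxT) U hUo hxU
    refine ⟨y, interior_subset hyT, lt_of_le_of_ne (hU y hyU (interior_subset hyT)) fun h0 => ?_⟩
    -- An interior point on the hyperplane could be pushed along -ν to the forbidden side while
    -- staying in the simplex.
    have hev : ∀ᶠ t : ℝ in 𝓝 0, y - t • ν ∈ U ∩ interior (convexHull ℝ (Set.range T)) := by
      have : ContinuousAt (fun t : ℝ => y - t • ν) 0 := by fun_prop
      apply this
      simpa using (hUo.inter isOpen_interior).mem_nhds ⟨hyU, hyT⟩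
    obtain ⟨t, ht, ht0⟩ := ((hev.filter_mono nhdsWithin_le_nhds).and
      (self_mem_nhdsWithin (s := Ioi (0:ℝ)))).exists
    have h1 := hU _ ht.1 (interior_subset ht.2)
    have h2 : y - t • ν - x = (y - x) - t • ν := by abel
    rw [h2, inner_sub_left, ← h0, inner_smul_left, real_inner_self_eq_norm_sq, hν] at h1
    have : (0:ℝ) < t := ht0
    simp at h1
    linarith
  have hcoord : ∀ i, ∀ᶠ y in 𝓝 x, 0 ≤ inner ℝ (y - x) ν → 0 ≤ B.coord i y := by
    intro i
    by_cases hi : {x : Vec (d + 1) | inner ℝ x ν = c} ⊆ {x : Vec (d + 1) | inner ℝ x (v i) = a i}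
    -- An affine function that vanishes on the hyperplane is a multiple of the signed distance;
    -- evaluation at `y₀`, strictly on the positive side, shows that the multiple is nonnegative.
    · have hform : ∀ y, B.coord i y = inner ℝ ν (v i) * inner ℝ (y - x) ν := by
        intro y
        have hmem : y - (inner ℝ (y - x) ν) • ν ∈ {x : Vec (d + 1) | inner ℝ x ν = c} := by
          change inner ℝ _ ν = c
          rw [inner_sub_left, inner_smul_left, real_inner_self_eq_norm_sq, hν, inner_sub_left, hxc]
          simp
        have h1 : inner ℝ (y - (inner ℝ (y - x) ν) • ν) (v i) = a i := hi hmem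
        rw [inner_sub_left, inner_smul_left] at h1
        simp only [conj_trivial] at h1
        rw [hva]; linarith
      refine Eventually.of_forall fun y hy => ?_
      rw [hform]
      refine mul_nonneg ?_ hy
      have h1 : 0 ≤ B.coord i y₀ := by rw [hB] at hy₀T; exact hy₀T i
      rw [hform] at h1
      exact nonneg_of_mul_nonneg_left h1 hy₀
    · have hne : inner ℝ x (v i) ≠ a i := fun h => hx ⟨i, hi⟩ ⟨hxc, h⟩
      have hpos : 0 < B.coord i x := by
        rw [hB] at hxT
        refine lt_of_le_of_ne (hxT i) fun h0 => hne ?_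
        rw [hva] at h0; linarith
      have hcont : Continuous (B.coord i) := (B.coord i).continuous_of_finiteDimensional
      filter_upwards [hcont.continuousAt.eventually (lt_mem_nhds hpos)] with y hy _
      exact le_of_lt hy
  filter_upwards [eventually_all.2 hcoord] with y hy hy0
  rw [hB]
  exact fun i => hy i hy0

/-- A polytope with null intersection with a set that is locally a half-space lies locally on the
other side. -/
theorem IsPolytope.nonneg_of_overlap_null {n : ℕ} {K K' : Set (Vec n)} (hK : IsPolytope K)
    (h0 : volume (K ∩ K') = 0) {x ν : Vec n}
    (hloc : ∀ᶠ y in 𝓝 x, y ∈ K' ↔ inner ℝ (y - x) ν ≤ 0) :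
    ∀ᶠ y in 𝓝 x, y ∈ K → 0 ≤ inner ℝ (y - x) ν := by
  obtain ⟨U, hU, hUo, hxU⟩ := eventually_nhds_iff.1 hloc
  filter_upwards [hUo.mem_nhds hxU] with y hyU hyK
  by_contra hneg
  have hVo : IsOpen (U ∩ {z : Vec n | inner ℝ (z - x) ν < 0}) :=
    hUo.inter (isOpen_lt (by fun_prop) continuous_const)
  obtain ⟨z, hz, hzK⟩ := mem_closure_iff.1 (hK.subset_closure_interior hyK) _ hVo
    ⟨hyU, not_le.1 hneg⟩
  have hpos := (hVo.inter isOpen_interior).measure_pos volume ⟨z, hz, hzK⟩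
  refine hpos.ne' (measure_mono_null ?_ h0)
  rintro w ⟨⟨hwU, hw⟩, hwK⟩
  exact ⟨interior_subset hwK, (hU w hwU).2 (le_of_lt hw)⟩

theorem HasOuterNormal.measure_eq_zero {K S : Set (Vec (d + 1))} {ν : Vec (d + 1)}
    (h : HasOuterNormal K S ν) (hS : IsClosed S) :
    (μHE[d] : Measure (Vec (d + 1)))
      {x | ¬ (x ∈ S → ∀ᶠ y in 𝓝 x, y ∈ K ↔ inner ℝ (y - x) ν ≤ 0)} = 0 := by
  have h1 := (ae_restrict_iff' hS.measurableSet).1 h.2.2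
  have h2 : ∀ᵐ x ∂(μHE[d] : Measure (Vec (d + 1))),
      x ∈ S → ∀ᶠ y in 𝓝 x, y ∈ K ↔ inner ℝ (y - x) ν ≤ 0 := by
    filter_upwards [h1] with x hx hxS
    exact Metric.eventually_nhds_iff_ball.2 (hx hxS)
  exact h2

end Polytope

/-! ### Boundary regularity of the mesh -/

namespace Mesh

variable {d : ℕ} {Ω : Set (Vec (d + 1))} {ι κ : Type*} (M : Mesh (d + 1) Ω ι κ)

theorem isCompact_cell {n : ℕ} {Ω : Set (Vec n)} (M : Mesh n Ω ι κ) (K : ι) :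
    IsCompact (M.cell K) := (M.cell_polytope K).isCompact

theorem norm_normal {n : ℕ} {Ω : Set (Vec n)} (M : Mesh n Ω ι κ) (S : κ) : ‖M.normal S‖ = 1 :=
  (M.plus_normal S).1

open Classical in
/-- The sign of the normal of the face `S` relative to the outward normal of the cell `K`. -/
noncomputable def orient {n : ℕ} {Ω : Set (Vec n)} (M : Mesh n Ω ι κ) (K : ι) (S : κ) : ℝ :=
  (if M.plus S = K then 1 else 0) - (if M.minus S = some K then 1 else 0)

/-- At almost every point of an interior face K_+ and K_- fill the two sides, so a third cell would
lie locally in the hyperplane, although it has interior points nearby. At a boundary face a further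
cell would fill the side opposite to K_+, making the point interior to closure Ω, hence a point of
Ω, whereas it lies on the frontier. -/
theorem face_inter_cell_null (hΩ_open : IsOpen Ω) (hΩ_reg : interior (closure Ω) = Ω) {K : ι}
    {S : κ} (hp : M.plus S ≠ K) (hm : M.minus S ≠ some K) :
    (μHE[d] : Measure (Vec (d + 1))) (M.face S ∩ M.cell K) = 0 := by
  have hνp := (M.plus_normal S).measure_eq_zero (M.face_closed S)
  have hov := M.cell_overlap hp.symm
  rcases hmin : M.minus S with _ | K'
  · obtain ⟨c, hc⟩ := M.face_hyperplane S
    obtain ⟨N, T, hT, hKT⟩ := M.cell_polytope K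
    refine measure_mono_null ?_ (measure_union_null hνp
      (measure_iUnion_null fun i => simplex_fills_halfspace_ae (M.norm_normal S) c (hT i)))
    rintro x ⟨hxS, hxK⟩
    by_contra hx
    rw [mem_union, not_or, mem_iUnion, not_exists] at hx
    obtain ⟨hx1, hx2⟩ := hx
    have hloc := not_not.1 hx1 hxS
    have hside := (M.cell_polytope K).nonneg_of_overlap_null hov hloc
    obtain ⟨i, hi⟩ := mem_iUnion.1 (hKT ▸ hxK)
    have hsubK : convexHull ℝ (Set.range (T i)) ⊆ M.cell K := by
      rw [hKT]; exact subset_iUnion (fun i => convexHull ℝ (Set.range (T i))) i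
    have hfill : ∀ᶠ y in 𝓝 x, 0 ≤ inner ℝ (y - x) (M.normal S) →
        y ∈ convexHull ℝ (Set.range (T i)) := by
      by_contra hcon
      exact hx2 i ⟨hc hxS, hi, hside.mono fun y hy hyT => hy (hsubK hyT), hcon⟩
    have hint : x ∈ interior (closure Ω) := by
      rw [mem_interior_iff_mem_nhds]
      filter_upwards [hloc, hfill] with y h1 h2
      rw [← M.cell_cover, mem_iUnion]
      rcases le_total (inner ℝ (y - x) (M.normal S)) 0 with h | h
      · exact ⟨_, h1.2 h⟩
      · exact ⟨_, hsubK (h2 h)⟩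
    rw [hΩ_reg] at hint
    have := (M.boundary S hmin hxS).2
    rw [hΩ_open.interior_eq] at this
    exact this hint
  · have hνm := (M.minus_normal S K' hmin).measure_eq_zero (M.face_closed S)
    have hov' := M.cell_overlap (show K ≠ K' by rintro rfl; exact hm hmin)
    refine measure_mono_null ?_ (measure_union_null hνp hνm)
    rintro x ⟨hxS, hxK⟩
    by_contra hx
    rw [mem_union, not_or] at hx
    have h1 := (M.cell_polytope K).nonneg_of_overlap_null hov (not_not.1 hx.1 hxS)
    have h2 := (M.cell_polytope K).nonneg_of_overlap_null hov' (not_not.1 hx.2 hxS)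
    obtain ⟨U, hU, hUo, hxU⟩ := eventually_nhds_iff.1 (h1.and h2)
    obtain ⟨z, hz⟩ := mem_closure_iff.1 ((M.cell_polytope K).subset_closure_interior hxK) _ hUo hxU
    have hpos := (hUo.inter isOpen_interior).measure_pos volume ⟨z, hz⟩
    have hne : M.normal S ≠ 0 := by
      intro h0; have := M.norm_normal S; simp [h0] at this
    refine hpos.ne' (measure_mono_null ?_ (volume_level_eq_zero hne (inner ℝ x (M.normal S))))
    rintro w ⟨hwU, hwK⟩
    obtain ⟨h3, h4⟩ := hU w hwU
    have h3 := h3 (interior_subset hwK)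
    have h4 := h4 (interior_subset hwK)
    rw [inner_neg_right, inner_sub_left] at h4
    rw [inner_sub_left] at h3
    change inner ℝ w _ = _
    linarith

/-- A cell on both sides would agree near some point of the face with both opposite half-spaces;
points x + tν with small t > 0 distinguish them. Positive surface measure of the face provides such
a point. -/
theorem plus_ne_minus {S : κ} {K : ι} (h : M.minus S = some K) : M.plus S ≠ K := by
  intro hp
  have h1 := (M.plus_normal S).measure_eq_zero (M.face_closed S)
  have h2 := (M.minus_normal S K h).measure_eq_zero (M.face_closed S)
  have hpos : (μHE[d] : Measure (Vec (d + 1))) (M.face S) ≠ 0 := (M.face_pos S).ne'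
  apply hpos
  refine measure_mono_null ?_ (measure_union_null h1 h2)
  intro x hxS
  by_contra hx
  rw [mem_union, not_or] at hx
  have h1 := not_not.1 hx.1 hxS
  have h2 := not_not.1 hx.2 hxS
  rw [hp] at h1
  have hc : Tendsto (fun t : ℝ => x + t • M.normal S) (𝓝[>] 0) (𝓝 x) := by
    have : ContinuousAt (fun t : ℝ => x + t • M.normal S) 0 := by fun_prop
    have := this.tendsto
    simp only [zero_smul, add_zero] at this
    exact this.mono_left nhdsWithin_le_nhds
  obtain ⟨t, ⟨ht1, ht2⟩, ht0⟩ := ((hc.eventually (h1.and h2)).and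
    (self_mem_nhdsWithin (s := Ioi (0:ℝ)))).exists
  have ht0 : (0:ℝ) < t := ht0
  simp only [add_sub_cancel_left, inner_neg_right, inner_smul_left, real_inner_self_eq_norm_sq,
    M.norm_normal S] at ht1 ht2
  simp at ht1 ht2
  have h5 := ht2.2 ht0.le
  have := ht1.1 h5
  linarith

theorem orient_plus (S : κ) : M.orient (M.plus S) S = 1 := by
  have : M.minus S ≠ some (M.plus S) := fun h => M.plus_ne_minus h rfl
  simp [orient, this]

theorem orient_minus {S : κ} {K : ι} (h : M.minus S = some K) : M.orient K S = -1 := by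
  simp [orient, M.plus_ne_minus h, h]

theorem orient_eq_zero {S : κ} {K : ι} (hp : M.plus S ≠ K) (hm : M.minus S ≠ some K) :
    M.orient K S = 0 := by
  simp [orient, hp, hm]

/-- Off a null set, each point of the boundary of a cell lies in exactly one face, and the cell is
near the point a half-space with the corresponding normal. -/
theorem exists_null_boundary_regular [Finite ι] [Finite κ] (hΩ_open : IsOpen Ω)
    (hΩ_reg : interior (closure Ω) = Ω) :
    ∃ N : Set (Vec (d + 1)), (μHE[d] : Measure (Vec (d + 1))) N = 0 ∧
      ∀ (K : ι), (∀ x ∈ frontier (M.cell K), x ∉ N →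
        ∃ S, x ∈ M.face S ∧ M.orient K S ≠ 0) ∧
      ∀ S, M.orient K S ≠ 0 → ∀ x ∈ M.face S, x ∉ N →
        x ∈ frontier (M.cell K) ∧ (∀ S', x ∈ M.face S' → S' = S) ∧
        (M.orient K S = 1 ∨ M.orient K S = -1) ∧
        ∀ᶠ y in 𝓝 x, y ∈ M.cell K ↔ M.orient K S * inner ℝ (y - x) (M.normal S) ≤ 0 := by
  -- Exceptional points: overlaps of two faces, failures of the half-space property for K_+ and for
  -- K_-, and contacts of a face with a cell other than these two.
  let N1 : Set (Vec (d + 1)) := ⋃ p : {p : κ × κ // p.1 ≠ p.2}, M.face p.1.1 ∩ M.face p.1.2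
  let N2 : Set (Vec (d + 1)) := ⋃ S : κ, {x | ¬ (x ∈ M.face S → ∀ᶠ y in 𝓝 x,
    y ∈ M.cell (M.plus S) ↔ inner ℝ (y - x) (M.normal S) ≤ 0)}
  let N3 : Set (Vec (d + 1)) := ⋃ p : {p : κ × ι // M.minus p.1 = some p.2},
    {x | ¬ (x ∈ M.face p.1.1 → ∀ᶠ y in 𝓝 x,
      y ∈ M.cell p.1.2 ↔ inner ℝ (y - x) (-M.normal p.1.1) ≤ 0)}
  let N4 : Set (Vec (d + 1)) := ⋃ p : {p : κ × ι // M.plus p.1 ≠ p.2 ∧ M.minus p.1 ≠ some p.2},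
    M.face p.1.1 ∩ M.cell p.1.2
  refine ⟨N1 ∪ N2 ∪ N3 ∪ N4, ?_, fun K => ⟨fun x hx hxN => ?_, fun S hS x hxS hxN => ?_⟩⟩
  · refine measure_union_null (measure_union_null (measure_union_null ?_ ?_) ?_) ?_
    · exact measure_iUnion_null fun p => M.face_overlap p.2
    · exact measure_iUnion_null fun S => (M.plus_normal S).measure_eq_zero (M.face_closed S)
    · exact measure_iUnion_null fun p =>
        (M.minus_normal _ _ p.2).measure_eq_zero (M.face_closed _)
    · exact measure_iUnion_null fun p => M.face_inter_cell_null hΩ_open hΩ_reg p.2.1 p.2.2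
  · have hmem : x ∈ ⋃ S, M.face S := by
      rw [M.face_cover]; exact mem_iUnion.2 ⟨K, hx⟩
    obtain ⟨S, hS⟩ := mem_iUnion.1 hmem
    refine ⟨S, hS, fun h0 => ?_⟩
    apply hxN
    right
    by_cases hp : M.plus S = K
    · rw [← hp, M.orient_plus] at h0; norm_num at h0
    by_cases hm : M.minus S = some K
    · rw [M.orient_minus hm] at h0; norm_num at h0
    exact mem_iUnion.2 ⟨⟨(S, K), hp, hm⟩, hS, (M.isCompact_cell K).isClosed.frontier_subset hx⟩
  · simp only [mem_union, not_or] at hxN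
    obtain ⟨⟨⟨h1, h2⟩, h3⟩, h4⟩ := hxN
    have huniq : ∀ S', x ∈ M.face S' → S' = S := by
      intro S' hS'
      by_contra hne
      exact h1 (mem_iUnion.2 ⟨⟨(S', S), hne⟩, hS', hxS⟩)
    by_cases hp : M.plus S = K
    · subst hp
      refine ⟨(M.plus_normal S).2.1 hxS, huniq, Or.inl (M.orient_plus S), ?_⟩
      rw [M.orient_plus S]
      simp only [one_mul]
      by_contra hcon
      exact h2 (mem_iUnion.2 ⟨S, fun h => hcon (h hxS)⟩)
    by_cases hm : M.minus S = some K
    · refine ⟨(M.minus_normal S K hm).2.1 hxS, huniq, Or.inr (M.orient_minus hm), ?_⟩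
      rw [M.orient_minus hm]
      by_contra hcon
      refine h3 (mem_iUnion.2 ⟨⟨(S, K), hm⟩, fun h => hcon ?_⟩)
      simpa [inner_neg_right] using h hxS
    · exact absurd (M.orient_eq_zero hp hm) hS

theorem volume_frontier_cell [Finite κ] (K : ι) : volume (frontier (M.cell K)) = 0 := by
  choose c hc using M.face_hyperplane
  refine measure_mono_null (t := ⋃ S, {x | inner ℝ x (M.normal S) = c S}) ?_
    (measure_iUnion_null fun S => volume_level_eq_zero ?_ _)
  · intro x hx
    have hmem : x ∈ ⋃ S, M.face S := by
      rw [M.face_cover]; exact mem_iUnion.2 ⟨K, hx⟩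
    obtain ⟨S, hS⟩ := mem_iUnion.1 hmem
    exact mem_iUnion.2 ⟨S, hc S hS⟩
  · intro h0; have := M.norm_normal S; simp [h0] at this

/-- A frontier point of Ω lies in some cell but not in its interior, since interior (closure Ω) = Ω;
the cell boundaries are null because they lie in finitely many hyperplanes. -/
theorem volume_frontier_domain (M : Mesh (d + 1) Ω ι κ) [Finite ι] [Finite κ] (hΩ_open : IsOpen Ω)
    (hΩ_reg : interior (closure Ω) = Ω) : volume (frontier Ω) = 0 := by
  refine measure_mono_null (t := ⋃ K, frontier (M.cell K)) ?_
    (measure_iUnion_null fun K => M.volume_frontier_cell K)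
  intro x hx
  have hxc : x ∈ ⋃ K, M.cell K := by rw [M.cell_cover]; exact hx.1
  obtain ⟨K, hK⟩ := mem_iUnion.1 hxc
  refine mem_iUnion.2 ⟨K, subset_closure hK, fun hi => hx.2 ?_⟩
  rw [hΩ_open.interior_eq, ← hΩ_reg]
  refine interior_mono ?_ hi
  rw [← M.cell_cover]
  exact subset_iUnion _ K

theorem isBounded_face (S : κ) : Bornology.IsBounded (M.face S) :=
  (M.isCompact_cell (M.plus S)).isBounded.subset
    ((M.plus_normal S).2.1.trans (M.isCompact_cell _).isClosed.frontier_subset)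

theorem isCompact_face (S : κ) : IsCompact (M.face S) :=
  Metric.isCompact_of_isClosed_isBounded (M.face_closed S) (M.isBounded_face S)

theorem hausdorff_face_lt_top (S : κ) : (μHE[d] : Measure (Vec (d + 1))) (M.face S) < ⊤ := by
  obtain ⟨c, hc⟩ := M.face_hyperplane S
  exact hausdorff_lt_top_of_isBounded (M.norm_normal S) (M.isBounded_face S) hc

/-- A face of zero diameter is at most one point, which is surface-null as soon as d ≥ 1. This is
where n ≥ 2 enters; positive h_S is needed for the weights in Young's inequality. -/
theorem diam_face_pos (hd : 1 ≤ d) (S : κ) : 0 < Metric.diam (M.face S) := by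
  refine Metric.diam_pos ?_ (M.isBounded_face S)
  by_contra hsub
  rw [Set.not_nontrivial_iff] at hsub
  obtain ⟨c, hc⟩ := M.face_hyperplane S
  obtain ⟨b, L, h1, -⟩ := exists_affine_chart (M.norm_normal S) c
  have hpos : (μHE[d] : Measure (Vec (d + 1))) (M.face S) ≠ 0 := (M.face_pos S).ne'
  apply hpos
  rw [hausdorff_apply_of_subset_range (b := b) (L := L) (by rwa [h1])]
  have : Nonempty (Fin d) := ⟨⟨0, hd⟩⟩
  exact (hsub.preimage (isometry_chart b L).injective).measure_zero _

end Mesh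

/-! ### The Gauss-Green formula by slicing along coordinate axes -/

section GaussGreen

variable {d : ℕ}

theorem insCoord_eq_add (j : Fin (d + 1)) (t : ℝ) (y : Vec d) :
    insCoord j t y = insCoord j 0 y + t • EuclideanSpace.single j 1 := by
  ext i
  rcases Fin.eq_self_or_eq_succAbove j i with rfl | ⟨i, rfl⟩ <;> simp

theorem continuous_insCoord (j : Fin (d + 1)) :
    Continuous fun z : ℝ × Vec d => insCoord j z.1 z.2 := by
  refine (PiLp.continuous_toLp 2 _).comp (continuous_pi fun i => ?_)
  rcases Fin.eq_self_or_eq_succAbove j i with rfl | ⟨i, rfl⟩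
  · simpa using continuous_fst
  · simp only [Fin.insertNth_apply_succAbove]; fun_prop

theorem hasDerivAt_insCoord (j : Fin (d + 1)) (y : Vec d) (t : ℝ) :
    HasDerivAt (fun t => insCoord j t y) (EuclideanSpace.single j 1) t := by
  have : (fun t => insCoord j t y) =
      fun t : ℝ => insCoord j 0 y + t • EuclideanSpace.single j (1 : ℝ) :=
    funext fun t => insCoord_eq_add j t y
  rw [this]
  simpa using ((hasDerivAt_id t).smul_const (EuclideanSpace.single j (1 : ℝ))).const_add
    (insCoord j 0 y)

theorem continuous_liftHeight (j : Fin (d + 1)) (ν : Vec (d + 1)) (c : ℝ) :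
    Continuous (liftHeight j ν c) := by
  unfold liftHeight; fun_prop

/-- The set of base points whose lift lies in the face is closed and contained in the projection of
the face, hence compact. -/
theorem integrable_indicator_lift (j : Fin (d + 1)) (ν : Vec (d + 1)) (c : ℝ)
    {S : Set (Vec (d + 1))} (hS : IsCompact S) {F : Vec (d + 1) → ℝ} (hF : Continuous F) :
    Integrable fun y => S.indicator F (insCoord j (liftHeight j ν c y) y) := by
  have hcont : Continuous fun y => insCoord j (liftHeight j ν c y) y :=
    (continuous_insCoord j).comp ((continuous_liftHeight j ν c).prodMk continuous_id)
  have hcomp : IsCompact ((fun y => insCoord j (liftHeight j ν c y) y) ⁻¹' S) := by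
    refine (hS.image (dropCoord j).continuous_of_finiteDimensional).of_isClosed_subset
      (hS.isClosed.preimage hcont) ?_
    intro y hy
    exact ⟨_, hy, dropCoord_insCoord _ _ _⟩
  have h1 := ((hF.comp hcont).continuousOn.integrableOn_compact (μ := volume) hcomp)
  rw [← integrable_indicator_iff hcomp.measurableSet] at h1
  refine h1.congr (Eventually.of_forall fun y => ?_)
  exact Set.indicator_comp_right (fun y => insCoord j (liftHeight j ν c y) y)

namespace Mesh

variable {Ω : Set (Vec (d + 1))} {ι κ : Type*}

theorem orient_eq_one_or (M : Mesh (d + 1) Ω ι κ) {K : ι} {S : κ} (h : M.orient K S ≠ 0) :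
    M.orient K S = 1 ∨ M.orient K S = -1 := by
  by_cases hp : M.plus S = K
  · exact Or.inl (hp ▸ M.orient_plus S)
  by_cases hm : M.minus S = some K
  · exact Or.inr (M.orient_minus hm)
  exact absurd (M.orient_eq_zero hp hm) h

/-- The Gauss-Green formula on a cell of the mesh. -/
theorem integral_cell_fderiv [Fintype ι] [Fintype κ] (M : Mesh (d + 1) Ω ι κ)
    (hΩ_open : IsOpen Ω) (hΩ_reg : interior (closure Ω) = Ω) (K : ι) (j : Fin (d + 1))
    {f : Vec (d + 1) → ℝ} (hf : ContDiff ℝ 1 f) :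
    ∫ x in M.cell K, fderiv ℝ f x (EuclideanSpace.single j 1) =
      ∑ S, M.orient K S * (M.normal S j * ∫ x, f x ∂(M.surf S)) := by
  classical
  choose c hc using M.face_hyperplane
  obtain ⟨N, hN0, hN⟩ := M.exists_null_boundary_regular hΩ_open hΩ_reg
  obtain ⟨hN1, hN2⟩ := hN K
  set I : Finset κ := {S | M.orient K S ≠ 0 ∧ M.normal S j ≠ 0} with hI
  -- The sign of the j-th component of the outward normal: +1 where a line in direction e_j leaves
  -- the cell, -1 where it enters.
  set σ : κ → ℝ := fun S => M.orient K S * (SignType.sign (M.normal S j) : ℝ) with hσdef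
  have hσ : ∀ S ∈ I, σ S = 1 ∨ σ S = -1 := by
    intro S hS
    rw [hI, Finset.mem_filter] at hS
    obtain ⟨-, h1, h2⟩ := hS
    rcases lt_or_gt_of_ne h2 with h2 | h2 <;> rcases M.orient_eq_one_or h1 with h3 | h3 <;>
      simp [hσdef, h3, h2]
  have hσν : ∀ S, M.orient K S * M.normal S j = σ S * |M.normal S j| := by
    intro S
    rw [hσdef, mul_assoc, sign_mul_abs]
  have hfd : Continuous fun x => fderiv ℝ f x (EuclideanSpace.single j 1) :=
    (hf.continuous_fderiv (by norm_num)).clm_apply continuous_const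
  have hKc := M.isCompact_cell K
  have hKm := hKc.isClosed.measurableSet
  have hfub := (integral_eq_integral_insCoord j
    ((integrable_indicator_iff hKm).2 (hfd.continuousOn.integrableOn_compact hKc))).2
  rw [integral_indicator hKm] at hfub
  rw [hfub]
  have hslice : ∀ᵐ y : Vec d, ∫ t : ℝ, (M.cell K).indicator
      (fun x => fderiv ℝ f x (EuclideanSpace.single j 1)) (insCoord j t y) =
      ∑ S ∈ I, σ S * (M.face S).indicator f
        (insCoord j (liftHeight j (M.normal S) (c S) y) y) := by
    have hb1 : volume (dropCoord j '' N) = 0 := volume_image_dropCoord_eq_zero j hN0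
    have hb2 : volume (⋃ S : {S // M.normal S j = 0},
        dropCoord j '' {x | inner ℝ x (M.normal S.1) = c S.1}) = 0 :=
      measure_iUnion_null fun S =>
        volume_image_dropCoord_hyperplane j (M.norm_normal S.1) S.2 _
    filter_upwards [compl_mem_ae_iff.2 hb1, compl_mem_ae_iff.2 hb2] with y hy1 hy2
    have hyN : ∀ t, insCoord j t y ∉ N := fun t ht => hy1 ⟨_, ht, dropCoord_insCoord j t y⟩
    have hct : Continuous fun t => insCoord j t y :=
      (continuous_insCoord j).comp (continuous_id.prodMk continuous_const)
    set A : Set ℝ := (fun t => insCoord j t y) ⁻¹' M.cell K with hA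
    have hAc : IsCompact A := by
      refine (hKc.image (f := fun x : Vec (d + 1) => x j) (by fun_prop)).of_isClosed_subset
        (hKc.isClosed.preimage hct) ?_
      intro t ht
      exact ⟨_, ht, insCoord_apply_same j t y⟩
    set p : κ → ℝ := fun S => liftHeight j (M.normal S) (c S) y with hp
    set I' : Finset κ := I.filter fun S => insCoord j (p S) y ∈ M.face S with hI'
    have hmem : ∀ S ∈ I', M.orient K S ≠ 0 ∧ M.normal S j ≠ 0 ∧ insCoord j (p S) y ∈ M.face S := by
      intro S hS
      simp only [hI', hI, Finset.mem_filter, Finset.mem_univ, true_and] at hS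
      exact ⟨hS.1.1, hS.1.2, hS.2⟩
    have h1d := integral_deriv_of_locally_halfline hAc I' p σ ?_
      (fun S hS => hσ S (Finset.mem_filter.1 hS).1) ?_ ?_
      (g := fun t => f (insCoord j t y))
      (g' := fun t => fderiv ℝ f (insCoord j t y) (EuclideanSpace.single j 1)) ?_ (hfd.comp hct)
    · rw [← integral_indicator hAc.isClosed.measurableSet] at h1d
      have e1 : (fun t => (M.cell K).indicator
          (fun x => fderiv ℝ f x (EuclideanSpace.single j 1)) (insCoord j t y)) =
          A.indicator fun t => fderiv ℝ f (insCoord j t y) (EuclideanSpace.single j 1) := by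
        ext t
        by_cases ht : insCoord j t y ∈ M.cell K
        · rw [Set.indicator_of_mem ht, Set.indicator_of_mem (s := A) ht]
        · rw [Set.indicator_of_notMem ht, Set.indicator_of_notMem (s := A) ht]
      rw [e1, h1d, hI', Finset.sum_filter]
      refine Finset.sum_congr rfl fun S _ => ?_
      split_ifs with hS
      · rw [Set.indicator_of_mem hS]
      · rw [Set.indicator_of_notMem hS, mul_zero]
    · intro S hS S' hS' hSS
      obtain ⟨h1, -, h2⟩ := hmem S hS
      obtain ⟨-, -, h3⟩ := hmem S' hS'
      rw [← hSS] at h3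
      exact ((hN2 S h1 _ h2 (hyN _)).2.1 S' h3).symm
    · intro S hS
      obtain ⟨h1, h2, h3⟩ := hmem S hS
      have hl := (hN2 S h1 _ h3 (hyN _)).2.2.2
      filter_upwards [hct.continuousAt.eventually hl] with u hu
      rw [hA, mem_preimage, hu, inner_sub_left, inner_insCoord, inner_insCoord]
      have : M.orient K S * (u * M.normal S j + inner ℝ y (dropCoord j (M.normal S)) -
          (p S * M.normal S j + inner ℝ y (dropCoord j (M.normal S)))) =
          (σ S * (u - p S)) * |M.normal S j| := by
        linear_combination (u - p S) * hσν S
      rw [this]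
      have hpos := abs_pos.2 h2
      constructor
      · intro h; by_contra hcon; push Not at hcon; nlinarith [mul_pos hcon hpos]
      · intro h; exact mul_nonpos_of_nonpos_of_nonneg h hpos.le
    · intro t ht
      have ht' : insCoord j t y ∈ frontier (M.cell K) := hct.frontier_preimage_subset _ ht
      obtain ⟨S, hxS, hor⟩ := hN1 _ ht' (hyN t)
      have hν : M.normal S j ≠ 0 := by
        intro h0
        exact hy2 (mem_iUnion.2 ⟨⟨S, h0⟩, _, hc S hxS, dropCoord_insCoord j t y⟩)
      have hpt : p S = t := by
        have := insCoord_liftHeight hν (hc S hxS)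
        rwa [dropCoord_insCoord, insCoord_apply_same] at this
      refine ⟨S, ?_, hpt⟩
      simp only [hI', hI, Finset.coe_filter, Finset.mem_filter, Finset.mem_univ, true_and]
      exact ⟨⟨hor, hν⟩, by rw [hpt]; exact hxS⟩
    · intro t
      exact (hf.differentiable (by norm_num) _).hasFDerivAt.comp_hasDerivAt t
        (hasDerivAt_insCoord j y t)
  rw [integral_congr_ae hslice, integral_finsetSum]
  · rw [← Finset.sum_subset (Finset.subset_univ I)]
    -- The change of variables contributes |ν_j|, and `hσν` combines it with the crossing sign into
    -- the oriented normal component.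
    · refine Finset.sum_congr rfl fun S hS => ?_
      have hν : M.normal S j ≠ 0 := (Finset.mem_filter.1 hS).2.2
      rw [integral_const_mul, ← integral_face_eq_integral_proj j (M.norm_normal S) hν
        (M.face_closed S) (hc S), ← mul_assoc, ← hσν, mul_assoc]
      rfl
    · intro S _ hS
      simp only [hI, Finset.mem_filter, Finset.mem_univ, true_and, not_and_or, not_not] at hS
      rcases hS with h | h <;> simp [h]
  · intro S _
    exact (integrable_indicator_lift j _ _ (M.isCompact_face S) hf.continuous).const_mul _

end Mesh

end GaussGreen

/-! ### Calculus and finite dimensionality of polynomial spaces -/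

section Polynomial

variable {n : ℕ}

theorem hasFDerivAt_eval (p : MvPolynomial (Fin n) ℝ) (x : Vec n) :
    ∃ L : Vec n →L[ℝ] ℝ, HasFDerivAt (fun x : Vec n => MvPolynomial.eval (fun j => x j) p) L x ∧
      ∀ j, L (EuclideanSpace.single j 1) =
        MvPolynomial.eval (fun j => x j) (MvPolynomial.pderiv j p) := by
  induction p using MvPolynomial.induction_on with
  | C a => exact ⟨0, by simpa using hasFDerivAt_const a x, by simp⟩
  | add p q hp hq =>
    obtain ⟨L, h1, h2⟩ := hp
    obtain ⟨L', h1', h2'⟩ := hq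
    exact ⟨L + L', by simpa using h1.fun_add h1', fun j => by simp [h2, h2']⟩
  | mul_X p i hp =>
    obtain ⟨L, h1, h2⟩ := hp
    have hX : HasFDerivAt (fun x : Vec n => x i) (EuclideanSpace.proj (𝕜 := ℝ) i) x :=
      (EuclideanSpace.proj (𝕜 := ℝ) i).hasFDerivAt
    refine ⟨_, by simpa using h1.fun_mul hX, fun j => ?_⟩
    simp only [add_apply, smul_apply, h2, smul_eq_mul,
      MvPolynomial.pderiv_mul, map_add, map_mul, MvPolynomial.eval_X, MvPolynomial.pderiv_X,
      PiLp.proj_apply]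
    by_cases hij : i = j
    · subst hij; simp; ring
    · simp [hij]; ring

theorem contDiff_eval (p : MvPolynomial (Fin n) ℝ) :
    ContDiff ℝ 1 fun x : Vec n => MvPolynomial.eval (fun j => x j) p := by
  induction p using MvPolynomial.induction_on with
  | C a => simpa using contDiff_const
  | add p q hp hq => simpa using hp.add hq
  | mul_X p i hp =>
    simp only [map_mul, MvPolynomial.eval_X]
    exact hp.mul (EuclideanSpace.proj (𝕜 := ℝ) i).contDiff

theorem fderiv_eval (p : MvPolynomial (Fin n) ℝ) (x : Vec n) (j : Fin n) :
    fderiv ℝ (fun x : Vec n => MvPolynomial.eval (fun j => x j) p) x (EuclideanSpace.single j 1) =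
      MvPolynomial.eval (fun j => x j) (MvPolynomial.pderiv j p) := by
  obtain ⟨L, h1, h2⟩ := hasFDerivAt_eval p x
  rw [h1.fderiv, h2]

theorem totalDegree_pderiv_le {p : MvPolynomial (Fin n) ℝ} {k : ℕ} (hp : p.totalDegree ≤ k + 1)
    (j : Fin n) : (MvPolynomial.pderiv j p).totalDegree ≤ k := by
  rw [p.as_sum, map_sum]
  refine (MvPolynomial.totalDegree_finsetSum _ _).trans (Finset.sup_le fun s hs => ?_)
  rw [MvPolynomial.pderiv_monomial]
  by_cases hsj : s j = 0
  · simp [hsj]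
  · refine (MvPolynomial.totalDegree_monomial_le _ _).trans ?_
    have h1 := (MvPolynomial.le_totalDegree hs).trans hp
    have h2 : s = (s - Finsupp.single j 1) + Finsupp.single j 1 := by
      ext i
      by_cases hij : i = j
      · subst hij; simp; omega
      · simp [Ne.symm hij]
    rw [h2, Finsupp.sum_add_index' (by simp) (by simp)] at h1
    simp only [Finsupp.sum_single_index] at h1
    change (s - Finsupp.single j 1).sum (fun _ e => e) ≤ k
    omega

variable {k : ℕ} {J : Type*}

theorem contDiff_coord {f : Vec n → EuclideanSpace ℝ J} (hf : f ∈ polySpace n k J) (i : J) :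
    ContDiff ℝ 1 fun x => f x i := by
  obtain ⟨p, -, hp⟩ := hf i
  simp_rw [hp]
  exact contDiff_eval p

theorem contDiff_poly [Fintype J] {f : Vec n → EuclideanSpace ℝ J} (hf : f ∈ polySpace n k J) :
    ContDiff ℝ 1 f :=
  contDiff_euclidean.2 fun i => contDiff_coord hf i

theorem continuous_poly [Fintype J] (f : polySpace n k J) : Continuous f.1 :=
  (contDiff_poly f.2).continuous

theorem fderiv_coord [Fintype J] {f : Vec n → EuclideanSpace ℝ J} (hf : f ∈ polySpace n k J)
    (x v : Vec n) (i : J) : fderiv ℝ (fun x => f x i) x v = fderiv ℝ f x v i := by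
  have h1 := ((contDiff_poly hf).differentiable (by norm_num) x).hasFDerivAt
  have h2 := (EuclideanSpace.proj (𝕜 := ℝ) i).hasFDerivAt.comp x h1
  have h3 : HasFDerivAt (fun x => f x i) ((EuclideanSpace.proj (𝕜 := ℝ) i).comp (fderiv ℝ f x)) x :=
    h2
  rw [h3.fderiv]
  rfl

/-- The Jacobian matrix of a polynomial, as a polynomial. -/
noncomputable def jacPoly (n m k : ℕ) :
    polySpace n (k + 1) (Fin m) →ₗ[ℝ] polySpace n k (Fin m × Fin n) where
  toFun v := ⟨jac v.1, fun ij => by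
    obtain ⟨p, hp, hpv⟩ := v.2 ij.1
    refine ⟨MvPolynomial.pderiv ij.2 p, totalDegree_pderiv_le hp ij.2, fun x => ?_⟩
    rw [← fderiv_eval]
    simp_rw [← hpv]
    exact (fderiv_coord v.2 x _ ij.1).symm⟩
  map_add' v w := by
    ext x ij
    have h1 := ((contDiff_poly v.2).differentiable (by norm_num) x)
    have h2 := ((contDiff_poly w.2).differentiable (by norm_num) x)
    change fderiv ℝ (v.1 + w.1) x _ ij.1 = fderiv ℝ v.1 x _ ij.1 + fderiv ℝ w.1 x _ ij.1
    rw [fderiv_add h1 h2]; rfl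
  map_smul' c v := by
    ext x ij
    have h1 := ((contDiff_poly v.2).differentiable (by norm_num) x)
    change fderiv ℝ (c • v.1) x _ ij.1 = c * fderiv ℝ v.1 x _ ij.1
    rw [fderiv_const_smul h1]; rfl

@[simp] theorem jacPoly_apply {m : ℕ} (v : polySpace n (k + 1) (Fin m)) :
    (jacPoly n m k v).1 = jac v.1 := rfl

/-- Multiplication of a matrix-valued polynomial by a vector. -/
noncomputable def mulVecPoly {m : ℕ} (k : ℕ) (ν : Vec n) :
    polySpace n k (Fin m × Fin n) →ₗ[ℝ] polySpace n k (Fin m) where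
  toFun R := ⟨fun x => mulVec (R.1 x) ν, fun i => by
    choose p hp hpR using fun j => R.2 (i, j)
    refine ⟨∑ j, ν j • p j, ?_, fun x => ?_⟩
    · exact (MvPolynomial.totalDegree_finsetSum _ _).trans
        (Finset.sup_le fun j _ => (MvPolynomial.totalDegree_smul_le _ _).trans (hp j))
    · simp [mulVec, hpR, MvPolynomial.smul_eval, mul_comm]⟩
  map_add' R R' := by
    ext x i
    simp [mulVec, add_mul, Finset.sum_add_distrib]
  map_smul' c R := by
    ext x i
    simp [mulVec, Finset.mul_sum, mul_assoc]

@[simp] theorem mulVecPoly_apply {m : ℕ} (ν : Vec n) (R : polySpace n k (Fin m × Fin n))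
    (x : Vec n) : (mulVecPoly k ν R).1 x = mulVec (R.1 x) ν := rfl

/-- The row-wise divergence of a polynomial. -/
noncomputable def dvgLin (n m k : ℕ) :
    polySpace n k (Fin m × Fin n) →ₗ[ℝ] (Vec n → Vec m) where
  toFun R := dvg R.1
  map_add' v w := by
    ext x i
    have h1 := ((contDiff_poly v.2).differentiable (by norm_num) x)
    have h2 := ((contDiff_poly w.2).differentiable (by norm_num) x)
    change ∑ j, fderiv ℝ (v.1 + w.1) x _ (i, j) =
      ∑ j, fderiv ℝ v.1 x _ (i, j) + ∑ j, fderiv ℝ w.1 x _ (i, j)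
    rw [fderiv_add h1 h2, ← Finset.sum_add_distrib]; rfl
  map_smul' c v := by
    ext x i
    have h1 := ((contDiff_poly v.2).differentiable (by norm_num) x)
    change ∑ j, fderiv ℝ (c • v.1) x _ (i, j) = c * ∑ j, fderiv ℝ v.1 x _ (i, j)
    rw [fderiv_const_smul h1, Finset.mul_sum]; rfl

theorem continuous_dvg {m : ℕ} (R : polySpace n k (Fin m × Fin n)) : Continuous (dvg R.1) := by
  refine (PiLp.continuous_toLp 2 _).comp (continuous_pi fun i => continuous_finsetSum _ fun j _ => ?_)
  have h1 := (contDiff_poly R.2).continuous_fderiv (by norm_num)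
  exact (EuclideanSpace.proj (𝕜 := ℝ) (i, j)).continuous.comp (h1.clm_apply continuous_const)

theorem exists_const_of_jac_eq_zero {m : ℕ} (v : polySpace n (k + 1) (Fin m))
    (h : jac v.1 = 0) : ∀ x, v.1 x = v.1 0 := by
  have hd := (contDiff_poly v.2).differentiable (by norm_num)
  have hz : ∀ x, fderiv ℝ v.1 x = 0 := by
    intro x
    apply ContinuousLinearMap.coe_injective
    refine (EuclideanSpace.basisFun (Fin n) ℝ).toBasis.ext fun j => ?_
    ext i
    have := congrArg (fun A : Mat m n => A (i, j)) (congrFun h x)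
    simpa [jac] using this
  exact fun x => is_const_of_fderiv_eq_zero hd hz x 0

theorem polySpace_mono {k k' : ℕ} (h : k ≤ k') : polySpace n k J ≤ polySpace n k' J :=
  fun _ hf i => let ⟨p, hp, hpf⟩ := hf i; ⟨p, hp.trans h, hpf⟩

theorem const_mem_polySpace (a : EuclideanSpace ℝ J) : (fun _ => a) ∈ polySpace n k J :=
  fun i => ⟨MvPolynomial.C (a i), by simp, by simp⟩

instance [Fintype J] : Module.Finite ℝ (polySpace n k J) := by
  let Φ : (J → MvPolynomial.restrictTotalDegree (Fin n) ℝ k) →ₗ[ℝ] polySpace n k J :=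
    { toFun := fun p => ⟨fun x => WithLp.toLp 2 fun i => MvPolynomial.eval (fun j => x j) (p i).1,
        fun i => ⟨(p i).1, (MvPolynomial.mem_restrictTotalDegree _ _ _).1 (p i).2, fun x => rfl⟩⟩
      map_add' := by intro p q; ext x i; simp
      map_smul' := by intro c p; ext x i; simp [MvPolynomial.smul_eval] }
  refine Module.Finite.of_surjective Φ fun f => ?_
  choose p hp hpf using f.2
  refine ⟨fun i => ⟨p i, (MvPolynomial.mem_restrictTotalDegree _ _ _).2 (hp i)⟩, ?_⟩
  ext x i
  exact (hpf i x).symm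

/-- An open set contains a box, and a polynomial that vanishes on a product of infinite sets is
zero. This makes the L² pairing on a cell definite. -/
theorem poly_eq_zero_of_isOpen (f : polySpace n k J) {U : Set (Vec n)} (hU : IsOpen U)
    (hne : U.Nonempty) (h : ∀ x ∈ U, f.1 x = 0) : f = 0 := by
  obtain ⟨x₀, hx₀⟩ := hne
  have hV : IsOpen ((WithLp.toLp 2 : (Fin n → ℝ) → Vec n) ⁻¹' U) :=
    hU.preimage (PiLp.continuous_toLp 2 _)
  obtain ⟨ε, hε, hball⟩ := Metric.isOpen_iff.1 hV (WithLp.ofLp x₀) hx₀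
  ext x i
  obtain ⟨p, -, hp⟩ := f.2 i
  have hp0 : p = 0 := by
    refine MvPolynomial.funext_set (fun j => Ioo (x₀ j - ε) (x₀ j + ε))
      (fun j => Ioo_infinite (by linarith)) fun y hy => ?_
    have hyU : WithLp.toLp 2 y ∈ U := by
      apply hball
      rw [Metric.mem_ball, dist_pi_lt_iff hε]
      intro j
      have := hy j (mem_univ j)
      rw [Real.dist_eq, abs_lt]
      constructor <;> linarith [this.1, this.2]
    have h1 := hp (WithLp.toLp 2 y)
    rw [h _ hyU] at h1
    simpa using h1.symm
  rw [hp, hp0]; simp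

end Polynomial

/-! ### Integrability, and integration by parts on a cell -/

section Integrability

variable {d : ℕ} {Ω : Set (Vec (d + 1))} {ι κ : Type*}

namespace Mesh

theorem isFiniteMeasure_surf (M : Mesh (d + 1) Ω ι κ) (S : κ) : IsFiniteMeasure (M.surf S) :=
  ⟨by rw [surf, Measure.restrict_apply_univ]; exact M.hausdorff_face_lt_top S⟩

theorem integrable_surf_of_le (M : Mesh (d + 1) Ω ι κ) (S : κ) {E : Type*} [NormedAddCommGroup E]
    {f : Vec (d + 1) → E} (hf : AEStronglyMeasurable f (M.surf S)) {g : Vec (d + 1) → ℝ}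
    (hg : Continuous g) (hfg : ∀ x, ‖f x‖ ≤ g x) : Integrable f (M.surf S) := by
  have := M.isFiniteMeasure_surf S
  obtain ⟨C, hC⟩ := (M.isCompact_face S).exists_bound_of_continuousOn hg.continuousOn
  refine Integrable.of_bound hf C ?_
  refine (ae_restrict_iff' (M.face_closed S).measurableSet).2 (Eventually.of_forall fun x hx => ?_)
  exact (hfg x).trans ((le_abs_self _).trans (hC x hx))

theorem integrable_surf (M : Mesh (d + 1) Ω ι κ) (S : κ) {f : Vec (d + 1) → ℝ}
    (hf : Continuous f) : Integrable f (M.surf S) :=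
  M.integrable_surf_of_le S hf.aestronglyMeasurable hf.norm fun _ => le_rfl

theorem integrableOn_cell {n : ℕ} {Ω : Set (Vec n)} (M : Mesh n Ω ι κ) (K : ι) {f : Vec n → ℝ}
    (hf : Continuous f) : IntegrableOn f (M.cell K) :=
  hf.continuousOn.integrableOn_compact (M.isCompact_cell K)

theorem poly_eq_zero_of_integral_cell {n k : ℕ} {J : Type*} [Fintype J] {Ω : Set (Vec n)}
    (M : Mesh n Ω ι κ) (K : ι) (f : polySpace n k J)
    (h : ∫ x in M.cell K, inner ℝ (f.1 x) (f.1 x) = 0) : f = 0 := by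
  have hc := continuous_poly f
  have hK := M.isCompact_cell K
  have hcont : Continuous fun x => inner ℝ (f.1 x) (f.1 x) := hc.inner hc
  have hint : (interior (M.cell K)).Nonempty := by
    by_contra hne
    rw [Set.not_nonempty_iff_eq_empty] at hne
    have h1 := (M.cell_polytope K).subset_closure_interior
    rw [hne, closure_empty] at h1
    have h2 := M.cell_pos K
    rw [Set.subset_empty_iff.1 h1] at h2
    simp at h2
  refine poly_eq_zero_of_isOpen f isOpen_interior hint ?_
  have hae := (setIntegral_eq_zero_iff_of_nonneg_ae
    (Eventually.of_forall fun x => real_inner_self_nonneg) (M.integrableOn_cell K hcont)).1 h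
  have hae' := Measure.eqOn_open_of_ae_eq (μ := volume)
    (ae_restrict_of_ae_restrict_of_subset interior_subset hae) isOpen_interior
    hcont.continuousOn continuousOn_const
  intro x hx
  exact inner_self_eq_zero.1 (hae' hx)

/-- Integration by parts on a cell. -/
theorem integral_cell_by_parts [Fintype ι] [Fintype κ] (M : Mesh (d + 1) Ω ι κ)
    (hΩ_open : IsOpen Ω) (hΩ_reg : interior (closure Ω) = Ω) (K : ι) {m k k' : ℕ}
    (φ : polySpace (d + 1) k (Fin m)) (R : polySpace (d + 1) k' (Fin m × Fin (d + 1))) :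
    (∫ x in M.cell K, inner ℝ (φ.1 x) (dvg R.1 x)) + ∫ x in M.cell K, inner ℝ (jac φ.1 x) (R.1 x) =
      ∑ S, M.orient K S * ∫ x, inner ℝ (φ.1 x) (mulVec (R.1 x) (M.normal S)) ∂(M.surf S) := by
  have hjc : Continuous (jac φ.1) :=
    (continuous_poly (jacPoly (d + 1) m k ⟨φ.1, polySpace_mono (Nat.le_succ k) φ.2⟩))
  have hφ := continuous_poly φ
  have hR := continuous_poly R
  have hci : ∀ i, Continuous fun x => φ.1 x i := fun i => (contDiff_coord φ.2 i).continuous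
  have hcR : ∀ i, Continuous fun x => R.1 x i := fun i => (contDiff_coord R.2 i).continuous
  have hprod : ∀ (i : Fin m) (j : Fin (d + 1)), ContDiff ℝ 1 fun x => φ.1 x i * R.1 x (i, j) :=
    fun i j => (contDiff_coord φ.2 i).mul (contDiff_coord R.2 (i, j))
  have hpd : ∀ (i : Fin m) (j : Fin (d + 1)), Continuous fun x =>
      fderiv ℝ (fun x => φ.1 x i * R.1 x (i, j)) x (EuclideanSpace.single j 1) := fun i j =>
    ((hprod i j).continuous_fderiv (by norm_num)).clm_apply continuous_const
  rw [← integral_add (M.integrableOn_cell K (hφ.inner (continuous_dvg R)))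
    (M.integrableOn_cell K (hjc.inner hR))]
  have hpt : ∀ x, inner ℝ (φ.1 x) (dvg R.1 x) + inner ℝ (jac φ.1 x) (R.1 x) =
      ∑ i, ∑ j, fderiv ℝ (fun x => φ.1 x i * R.1 x (i, j)) x (EuclideanSpace.single j 1) := by
    intro x
    have h1 : ∀ i j, fderiv ℝ (fun x => φ.1 x i * R.1 x (i, j)) x (EuclideanSpace.single j 1) =
        φ.1 x i * fderiv ℝ R.1 x (EuclideanSpace.single j 1) (i, j) +
        R.1 x (i, j) * fderiv ℝ φ.1 x (EuclideanSpace.single j 1) i := by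
      intro i j
      rw [fderiv_fun_mul ((contDiff_coord φ.2 i).differentiable (by norm_num) x)
        ((contDiff_coord R.2 (i, j)).differentiable (by norm_num) x)]
      simp only [add_apply, smul_apply, smul_eq_mul,
        fderiv_coord φ.2, fderiv_coord R.2]
    simp_rw [h1, Finset.sum_add_distrib]
    rw [PiLp.inner_apply, PiLp.inner_apply, Fintype.sum_prod_type]
    simp only [dvg, jac, RCLike.inner_apply, conj_trivial]
    congr 1
    refine Finset.sum_congr rfl fun i _ => ?_
    rw [mul_comm, Finset.mul_sum]
  simp_rw [hpt]
  rw [integral_finsetSum _ fun i _ => (integrable_finsetSum _ fun j _ =>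
    (M.integrableOn_cell K (hpd i j)))]
  have hS : ∀ S, ∫ x, inner ℝ (φ.1 x) (mulVec (R.1 x) (M.normal S)) ∂(M.surf S) =
      ∑ i, ∑ j, M.normal S j * ∫ x, φ.1 x i * R.1 x (i, j) ∂(M.surf S) := by
    intro S
    simp_rw [← integral_const_mul]
    have hi : ∀ i j, Integrable (fun x => M.normal S j * (φ.1 x i * R.1 x (i, j))) (M.surf S) :=
      fun i j => M.integrable_surf S (continuous_const.mul ((hci i).mul (hcR _)))
    have hi' := fun i => integral_finsetSum Finset.univ (fun j _ => hi i j)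
    simp_rw [← hi']
    rw [← integral_finsetSum _ fun i _ => integrable_finsetSum _ fun j _ => hi i j]
    congr 1
    ext x
    rw [PiLp.inner_apply]
    refine Finset.sum_congr rfl fun i _ => ?_
    simp only [mulVec, RCLike.inner_apply, conj_trivial, Finset.sum_mul]
    exact Finset.sum_congr rfl fun j _ => by ring
  simp_rw [hS]
  have hGG : ∀ i, ∫ x in M.cell K, ∑ j,
      fderiv ℝ (fun x => φ.1 x i * R.1 x (i, j)) x (EuclideanSpace.single j 1) =
      ∑ j, ∑ S, M.orient K S * (M.normal S j * ∫ x, φ.1 x i * R.1 x (i, j) ∂(M.surf S)) := by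
    intro i
    rw [integral_finsetSum _ fun j _ => M.integrableOn_cell K (hpd i j)]
    exact Finset.sum_congr rfl fun j _ =>
      M.integral_cell_fderiv hΩ_open hΩ_reg K j (hprod i j)
  simp_rw [hGG, Finset.mul_sum]
  rw [Finset.sum_comm (s := (Finset.univ : Finset κ))]
  exact Finset.sum_congr rfl fun i _ => Finset.sum_comm

end Mesh

end Integrability

/-! ### Solvability of the defining equations of projections and reconstructions -/

section Reconstruction

/-- Fredholm alternative: in finite dimensions the range of β is the annihilator of the vectors
annihilated by all `β p`. Only the test space has to be finite dimensional, and β may be degenerate.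
-/
theorem exists_of_bilin {V A : Type*} [AddCommGroup V] [Module ℝ V] [AddCommGroup A] [Module ℝ A]
    [Module.Finite ℝ A] (β : V →ₗ[ℝ] A →ₗ[ℝ] ℝ) (l : A →ₗ[ℝ] ℝ)
    (h : ∀ a, (∀ p, β p a = 0) → l a = 0) : ∃ p, β p = l := by
  have h1 : l ∈ (LinearMap.range β).dualCoannihilator.dualAnnihilator := by
    rw [Submodule.mem_dualAnnihilator]
    intro a ha
    rw [Submodule.mem_dualCoannihilator] at ha
    exact h a fun p => ha _ ⟨p, rfl⟩
  rw [Subspace.dualCoannihilator_dualAnnihilator_eq] at h1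
  exact h1

/-- On a face the L² form is degenerate, as nonzero polynomials may vanish on a hyperplane. Such a
test function is zero almost everywhere, so the right-hand side vanishes as well and the projection
still exists. -/
theorem l2Proj_spec {n k : ℕ} {J : Type*} [Fintype J] {μ : Measure (Vec n)}
    (hμ : ∀ g : Vec n → ℝ, Continuous g → Integrable g μ) {f : Vec n → EuclideanSpace ℝ J}
    (hf : ∀ q : polySpace n k J, Integrable (fun x => inner ℝ (f x) (q.1 x)) μ)
    (q : polySpace n k J) :
    ∫ x, inner ℝ ((l2Proj k μ f).1 x) (q.1 x) ∂μ = ∫ x, inner ℝ (f x) (q.1 x) ∂μ := by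
  have hi : ∀ p q : polySpace n k J, Integrable (fun x => inner ℝ (p.1 x) (q.1 x)) μ :=
    fun p q => hμ _ ((continuous_poly p).inner (continuous_poly q))
  let β : polySpace n k J →ₗ[ℝ] polySpace n k J →ₗ[ℝ] ℝ :=
    LinearMap.mk₂ ℝ (fun p q => ∫ x, inner ℝ (p.1 x) (q.1 x) ∂μ)
      (fun p p' q => by
        rw [← integral_add (hi _ _) (hi _ _)]; congr 1; ext x; exact inner_add_left _ _ _)
      (fun c p q => by
        rw [smul_eq_mul, ← integral_const_mul]; congr 1; ext x
        exact real_inner_smul_left _ _ _)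
      (fun p q q' => by
        rw [← integral_add (hi _ _) (hi _ _)]; congr 1; ext x; exact inner_add_right _ _ _)
      (fun c p q => by
        rw [smul_eq_mul, ← integral_const_mul]; congr 1; ext x
        exact real_inner_smul_right _ _ _)
  let l : polySpace n k J →ₗ[ℝ] ℝ :=
    { toFun := fun q => ∫ x, inner ℝ (f x) (q.1 x) ∂μ
      map_add' := fun q q' => by
        rw [← integral_add (hf _) (hf _)]; congr 1; ext x; exact inner_add_right _ _ _
      map_smul' := fun c q => by
        rw [RingHom.id_apply, smul_eq_mul, ← integral_const_mul]; congr 1; ext x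
        exact real_inner_smul_right _ _ _ }
  have hex : ∃ p : polySpace n k J, ∀ q : polySpace n k J,
      ∫ x, inner ℝ (p.1 x) (q.1 x) ∂μ = ∫ x, inner ℝ (f x) (q.1 x) ∂μ := by
    obtain ⟨p, hp⟩ := exists_of_bilin β l fun q hq => by
      have h0 := (integral_eq_zero_iff_of_nonneg (fun x => real_inner_self_nonneg) (hi q q)).1 (hq q)
      refine integral_eq_zero_of_ae ?_
      filter_upwards [h0] with x hx
      have : q.1 x = 0 := inner_self_eq_zero.1 hx
      simp [this]
    exact ⟨p, fun q => congrArg (fun φ : polySpace n k J →ₗ[ℝ] ℝ => φ q) hp⟩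
  exact Classical.epsilon_spec hex q

namespace Mesh

variable {d : ℕ} {Ω : Set (Vec (d + 1))} {ι κ : Type*}

theorem jump_poly {n k : ℕ} {Ω : Set (Vec n)} {J : Type*} (M : Mesh n Ω ι κ) (S : κ)
    (φ : PwPoly ι n k J) (x : Vec n) :
    M.jump S (fun K => (φ K).1 x) = (M.jump S φ).1 x := by
  unfold jump
  cases M.minus S <;> simp

theorem jump_add {n : ℕ} {Ω : Set (Vec n)} {X : Type*} [AddCommGroup X] (M : Mesh n Ω ι κ) (S : κ)
    (a b : ι → X) : M.jump S (a + b) = M.jump S a + M.jump S b := by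
  unfold jump
  cases M.minus S <;> simp
  abel

theorem jump_smul {n : ℕ} {Ω : Set (Vec n)} {X : Type*} [AddCommGroup X] [Module ℝ X]
    (M : Mesh n Ω ι κ) (S : κ) (c : ℝ) (a : ι → X) : M.jump S (c • a) = c • M.jump S a := by
  unfold jump
  cases M.minus S <;> simp [smul_sub]

theorem jump_mulVec {n m k : ℕ} {Ω : Set (Vec n)} (M : Mesh n Ω ι κ) (S : κ)
    (τ : PwPoly ι n k (Fin m × Fin n)) (x : Vec n) :
    M.jump S (fun K => mulVec ((τ K).1 x) (M.normal S)) =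
      (M.jump S fun K => mulVecPoly k (M.normal S) (τ K)).1 x := by
  rw [← M.jump_poly]; rfl

/-- Writing jumps with orientation signs allows sums over faces to be exchanged with sums over
cells. -/
theorem jump_eq_sum [Fintype ι] (M : Mesh (d + 1) Ω ι κ) (S : κ) (a : ι → ℝ) :
    M.jump S a = ∑ K, M.orient K S * a K := by
  classical
  unfold jump orient
  simp_rw [sub_mul, Finset.sum_sub_distrib, ite_mul, one_mul, zero_mul]
  rcases h : M.minus S with _ | K <;> simp

section Integrals

theorem cellInt_add [Fintype ι] (M : Mesh (d + 1) Ω ι κ) {f g : ι → Vec (d + 1) → ℝ}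
    (hf : ∀ K, Continuous (f K)) (hg : ∀ K, Continuous (g K)) :
    M.cellInt (fun K x => f K x + g K x) = M.cellInt f + M.cellInt g := by
  unfold cellInt
  rw [← Finset.sum_add_distrib]
  exact Finset.sum_congr rfl fun K _ =>
    integral_add (M.integrableOn_cell K (hf K)) (M.integrableOn_cell K (hg K))

theorem cellInt_const_mul [Fintype ι] (M : Mesh (d + 1) Ω ι κ) (c : ℝ) (f : ι → Vec (d + 1) → ℝ) :
    M.cellInt (fun K x => c * f K x) = c * M.cellInt f := by
  unfold cellInt
  rw [Finset.mul_sum]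
  exact Finset.sum_congr rfl fun K _ => integral_const_mul _ _

theorem faceInt_add [Fintype κ] (M : Mesh (d + 1) Ω ι κ) {f g : κ → Vec (d + 1) → ℝ}
    (hf : ∀ S, Continuous (f S)) (hg : ∀ S, Continuous (g S)) :
    M.faceInt (fun S x => f S x + g S x) = M.faceInt f + M.faceInt g := by
  unfold faceInt
  rw [← Finset.sum_add_distrib]
  exact Finset.sum_congr rfl fun S _ =>
    integral_add (M.integrable_surf S (hf S)) (M.integrable_surf S (hg S))

theorem faceInt_const_mul [Fintype κ] (M : Mesh (d + 1) Ω ι κ) (c : ℝ) (f : κ → Vec (d + 1) → ℝ) :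
    M.faceInt (fun S x => c * f S x) = c * M.faceInt f := by
  unfold faceInt
  rw [Finset.mul_sum]
  exact Finset.sum_congr rfl fun S _ => integral_const_mul _ _

/-- The piecewise Jacobian. -/
noncomputable def pwJac (ι : Type*) (n m k : ℕ) :
    PwPoly ι n (k + 1) (Fin m) →ₗ[ℝ] PwPoly ι n k (Fin m × Fin n) :=
  LinearMap.pi fun K => jacPoly n m k ∘ₗ LinearMap.proj K

@[simp] theorem pwJac_apply {n m k : ℕ} (w : PwPoly ι n (k + 1) (Fin m)) (K : ι) :
    (pwJac ι n m k w K).1 = jac (w K).1 := rfl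

theorem continuous_jac {n m k : ℕ} (φ : polySpace n k (Fin m)) : Continuous (jac φ.1) :=
  continuous_poly (jacPoly n m k ⟨φ.1, polySpace_mono (Nat.le_succ k) φ.2⟩)

theorem jac_add {n m k : ℕ} (φ ψ : polySpace n k (Fin m)) :
    jac (φ + ψ).1 = jac φ.1 + jac ψ.1 :=
  congrArg Subtype.val ((jacPoly n m k).map_add ⟨φ.1, polySpace_mono (Nat.le_succ k) φ.2⟩
    ⟨ψ.1, polySpace_mono (Nat.le_succ k) ψ.2⟩)

theorem jac_smul {n m k : ℕ} (c : ℝ) (φ : polySpace n k (Fin m)) :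
    jac (c • φ).1 = c • jac φ.1 :=
  congrArg Subtype.val ((jacPoly n m k).map_smul c ⟨φ.1, polySpace_mono (Nat.le_succ k) φ.2⟩)

variable [Fintype ι]

/-- The `L²` pairing of piecewise polynomials. -/
noncomputable def cellForm (M : Mesh (d + 1) Ω ι κ) (k : ℕ) (J : Type*) [Fintype J] :
    PwPoly ι (d + 1) k J →ₗ[ℝ] PwPoly ι (d + 1) k J →ₗ[ℝ] ℝ :=
  LinearMap.mk₂ ℝ (fun p q => M.cellInt fun K x => inner ℝ ((p K).1 x) ((q K).1 x))
    (fun p p' q => by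
      rw [← M.cellInt_add (fun K => (continuous_poly _).inner (continuous_poly _))
        (fun K => (continuous_poly _).inner (continuous_poly _))]
      congr 1; ext K x; exact inner_add_left _ _ _)
    (fun c p q => by
      rw [smul_eq_mul, ← M.cellInt_const_mul]
      congr 1; ext K x; exact real_inner_smul_left _ _ _)
    (fun p q q' => by
      rw [← M.cellInt_add (fun K => (continuous_poly _).inner (continuous_poly _))
        (fun K => (continuous_poly _).inner (continuous_poly _))]
      congr 1; ext K x; exact inner_add_right _ _ _)
    (fun c p q => by
      rw [smul_eq_mul, ← M.cellInt_const_mul]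
      congr 1; ext K x; exact real_inner_smul_right _ _ _)

theorem cellForm_apply (M : Mesh (d + 1) Ω ι κ) {k : ℕ} {J : Type*} [Fintype J]
    (p q : PwPoly ι (d + 1) k J) :
    M.cellForm k J p q = M.cellInt fun K x => inner ℝ ((p K).1 x) ((q K).1 x) := rfl

theorem cellForm_self_eq_zero (M : Mesh (d + 1) Ω ι κ) {k : ℕ} {J : Type*} [Fintype J]
    {p : PwPoly ι (d + 1) k J} (h : M.cellForm k J p p = 0) : p = 0 := by
  rw [cellForm_apply, cellInt, Finset.sum_eq_zero_iff_of_nonneg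
    (fun K _ => integral_nonneg fun x => real_inner_self_nonneg)] at h
  funext K
  exact M.poly_eq_zero_of_integral_cell K _ (h K (Finset.mem_univ K))

variable [Fintype κ] {m k : ℕ}

theorem isGradRec_gradRec (M : Mesh (d + 1) Ω ι κ) (v : PrimalSpace ι κ (d + 1) m k) :
    M.IsGradRec v (M.gradRec v) := by
  let l : PwPoly ι (d + 1) k (Fin m × Fin (d + 1)) →ₗ[ℝ] ℝ :=
    { toFun := fun τ => - M.cellInt (fun K x => inner ℝ ((v.1 K).1 x) (dvg (τ K).1 x)) +
        M.faceInt (fun S x =>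
          inner ℝ ((v.2 S).1 x) (M.jump S fun K => mulVec ((τ K).1 x) (M.normal S)))
      map_add' := fun τ τ' => by
        simp_rw [jump_mulVec]
        have h1 : M.cellInt (fun K x => inner ℝ ((v.1 K).1 x) (dvg ((τ + τ') K).1 x)) =
            M.cellInt (fun K x => inner ℝ ((v.1 K).1 x) (dvg (τ K).1 x)) +
            M.cellInt (fun K x => inner ℝ ((v.1 K).1 x) (dvg (τ' K).1 x)) := by
          rw [← M.cellInt_add (fun K => (continuous_poly _).inner (continuous_dvg _))
            (fun K => (continuous_poly _).inner (continuous_dvg _))]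
          congr 1; ext K x
          rw [← inner_add_right]; congr 1
          exact congrFun ((dvgLin (d + 1) m k).map_add (τ K) (τ' K)) x
        rw [h1]
        have h2 : ∀ S x, (M.jump S fun K => mulVecPoly k (M.normal S) ((τ + τ') K)).1 x =
            (M.jump S fun K => mulVecPoly k (M.normal S) (τ K)).1 x +
            (M.jump S fun K => mulVecPoly k (M.normal S) (τ' K)).1 x := by
          intro S x
          have := M.jump_add S (fun K => mulVecPoly k (M.normal S) (τ K))
            (fun K => mulVecPoly k (M.normal S) (τ' K))
          have e : (fun K => mulVecPoly k (M.normal S) ((τ + τ') K)) =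
            (fun K => mulVecPoly k (M.normal S) (τ K)) +
            (fun K => mulVecPoly k (M.normal S) (τ' K)) := funext fun K => map_add _ _ _
          rw [e, this]; rfl
        simp_rw [h2, inner_add_right]
        rw [M.faceInt_add (fun K => (continuous_poly _).inner (continuous_poly _))
          (fun K => (continuous_poly _).inner (continuous_poly _))]
        ring
      map_smul' := fun c τ => by
        simp_rw [jump_mulVec]
        have h1 : M.cellInt (fun K x => inner ℝ ((v.1 K).1 x) (dvg ((c • τ) K).1 x)) =
            c * M.cellInt (fun K x => inner ℝ ((v.1 K).1 x) (dvg (τ K).1 x)) := by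
          rw [← M.cellInt_const_mul]
          congr 1; ext K x
          rw [← real_inner_smul_right]; congr 1
          exact congrFun ((dvgLin (d + 1) m k).map_smul c (τ K)) x
        rw [h1]
        have h2 : ∀ S x, (M.jump S fun K => mulVecPoly k (M.normal S) ((c • τ) K)).1 x =
            c • (M.jump S fun K => mulVecPoly k (M.normal S) (τ K)).1 x := by
          intro S x
          have := M.jump_smul S c (fun K => mulVecPoly k (M.normal S) (τ K))
          have e : (fun K => mulVecPoly k (M.normal S) ((c • τ) K)) =
            c • (fun K => mulVecPoly k (M.normal S) (τ K)) := funext fun K =>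
              (mulVecPoly k (M.normal S)).map_smul c (τ K)
          rw [e, this]; rfl
        simp_rw [h2, real_inner_smul_right]
        rw [M.faceInt_const_mul, RingHom.id_apply, smul_eq_mul]
        ring }
  have hex : ∃ G, M.IsGradRec v G := by
    obtain ⟨G, hG⟩ := exists_of_bilin (M.cellForm k (Fin m × Fin (d + 1))) l fun τ hτ => by
      rw [M.cellForm_self_eq_zero (hτ τ), map_zero]
    exact ⟨G, fun τ => congrArg (fun φ : _ →ₗ[ℝ] ℝ => φ τ) hG⟩
  exact Classical.epsilon_spec hex

theorem isDivRec_divRec (M : Mesh (d + 1) Ω ι κ) (τ : DualSpace ι κ (d + 1) m k) :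
    M.IsDivRec τ (M.divRec τ) := by
  let l : PwPoly ι (d + 1) k (Fin m) →ₗ[ℝ] ℝ :=
    { toFun := fun φ => - M.cellInt (fun K x => inner ℝ (jac (φ K).1 x) ((τ.1 K).1 x)) +
        M.faceInt (fun S x => inner ℝ (M.jump S fun K => (φ K).1 x) ((τ.2 S).1 x))
      map_add' := fun φ ψ => by
        simp_rw [jump_poly, jump_add, Pi.add_apply, jac_add, Submodule.coe_add, Pi.add_apply,
          inner_add_left]
        rw [M.cellInt_add (fun K => (continuous_jac _).inner (continuous_poly _))
            (fun K => (continuous_jac _).inner (continuous_poly _)),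
          M.faceInt_add (fun K => (continuous_poly _).inner (continuous_poly _))
          (fun K => (continuous_poly _).inner (continuous_poly _))]
        ring
      map_smul' := fun c φ => by
        simp_rw [jump_poly, jump_smul, Pi.smul_apply, jac_smul, Submodule.coe_smul, Pi.smul_apply,
          real_inner_smul_left]
        rw [M.cellInt_const_mul, M.faceInt_const_mul, RingHom.id_apply, smul_eq_mul]
        ring }
  have hex : ∃ D, M.IsDivRec τ D := by
    obtain ⟨G, hG⟩ := exists_of_bilin (M.cellForm k (Fin m)) l fun τ hτ => by
      rw [M.cellForm_self_eq_zero (hτ τ), map_zero]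
    exact ⟨G, fun τ => congrArg (fun φ : _ →ₗ[ℝ] ℝ => φ τ) hG⟩
  exact Classical.epsilon_spec hex

/-- The submodule underlying `Z(M)`. -/
noncomputable def ZSub (M : Mesh (d + 1) Ω ι κ) (m k : ℕ) :
    Submodule ℝ (PwPoly ι (d + 1) k (Fin m × Fin (d + 1))) where
  carrier := {z | ∀ w, M.cellForm k _ z (pwJac ι (d + 1) m k w) = 0}
  add_mem' := fun {a b} ha hb w => by
    rw [map_add, LinearMap.add_apply, ha w, hb w, add_zero]
  zero_mem' := fun w => by rw [map_zero, LinearMap.zero_apply]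
  smul_mem' := fun c a ha w => by
    rw [map_smul, LinearMap.smul_apply, ha w, smul_zero]

theorem isDualPotRec_dualPotRec (M : Mesh (d + 1) Ω ι κ) (τ : DualSpace ι κ (d + 1) m k) :
    M.IsDualPotRec τ (M.dualPotRec τ) := by
  let l₁ : PwPoly ι (d + 1) (k + 1) (Fin m) →ₗ[ℝ] ℝ :=
    { toFun := fun w => - M.cellInt (fun K x => inner ℝ ((w K).1 x) ((M.divRec τ K).1 x)) +
        M.faceInt (fun S x => inner ℝ (M.jump S fun K => (w K).1 x) ((τ.2 S).1 x))
      map_add' := fun φ ψ => by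
        simp_rw [jump_poly, jump_add, Pi.add_apply, Submodule.coe_add, Pi.add_apply,
          inner_add_left]
        rw [M.cellInt_add (fun K => (continuous_poly _).inner (continuous_poly _))
            (fun K => (continuous_poly _).inner (continuous_poly _)),
          M.faceInt_add (fun K => (continuous_poly _).inner (continuous_poly _))
          (fun K => (continuous_poly _).inner (continuous_poly _))]
        ring
      map_smul' := fun c φ => by
        simp_rw [jump_poly, jump_smul, Pi.smul_apply, Submodule.coe_smul, Pi.smul_apply,
          real_inner_smul_left]
        rw [M.cellInt_const_mul, M.faceInt_const_mul, RingHom.id_apply, smul_eq_mul]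
        ring }
  -- Both conditions on R are tested at once against D_pw w + z. Orthogonality of the summands
  -- reduces compatibility to the case z = 0 and D_pw w = 0.
  let comb : (PwPoly ι (d + 1) (k + 1) (Fin m) × M.ZSub m k) →ₗ[ℝ]
      PwPoly ι (d + 1) k (Fin m × Fin (d + 1)) :=
    (pwJac ι (d + 1) m k).coprod (M.ZSub m k).subtype
  let l : (PwPoly ι (d + 1) (k + 1) (Fin m) × M.ZSub m k) →ₗ[ℝ] ℝ :=
    l₁.coprod ((M.cellForm k _ τ.1) ∘ₗ (M.ZSub m k).subtype)
  -- Such a `w` is constant on each cell and therefore admissible as a test function for div_h τ,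
  -- whose definition is then exactly the required compatibility.
  have hl₁ : ∀ w, pwJac ι (d + 1) m k w = 0 → l₁ w = 0 := by
    intro w hw
    have hwc : ∀ K x, (w K).1 x = (w K).1 0 := fun K =>
      exists_const_of_jac_eq_zero (w K) (by
        rw [← pwJac_apply, hw]; rfl)
    let φ : PwPoly ι (d + 1) k (Fin m) := fun K => ⟨fun _ => (w K).1 0, const_mem_polySpace _⟩
    have hφw : ∀ K, (φ K).1 = (w K).1 := fun K => funext fun x => (hwc K x).symm
    have hdiv := M.isDivRec_divRec τ φ
    simp_rw [hφw] at hdiv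
    have hz : ∀ K, jac (w K).1 = 0 := fun K => by rw [← pwJac_apply, hw]; rfl
    have h0 : M.cellInt (fun K x => inner ℝ (jac (w K).1 x) ((τ.1 K).1 x)) = 0 := by
      simp [cellInt, hz]
    rw [h0, neg_zero, zero_add] at hdiv
    change - M.cellInt (fun K x => inner ℝ ((w K).1 x) ((M.divRec τ K).1 x)) + _ = 0
    rw [← hdiv]
    simp_rw [real_inner_comm]
    ring
  have hex : ∃ R, M.IsDualPotRec τ R := by
    let β : PwPoly ι (d + 1) k (Fin m × Fin (d + 1)) →ₗ[ℝ]
        (PwPoly ι (d + 1) (k + 1) (Fin m) × M.ZSub m k) →ₗ[ℝ] ℝ :=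
      (M.cellForm k (Fin m × Fin (d + 1))).compl₂ comb
    obtain ⟨R, hR⟩ := exists_of_bilin (A := PwPoly ι (d + 1) (k + 1) (Fin m) × M.ZSub m k) β l
      fun a ha => by
        obtain ⟨w, z⟩ := a
        have h0 : comb (w, z) = 0 := M.cellForm_self_eq_zero (ha (comb (w, z)))
        have h1 : pwJac ι (d + 1) m k w + z.1 = 0 := h0
        have hz : z.1 = 0 := by
          apply M.cellForm_self_eq_zero
          have h2 := z.2 w
          rw [eq_neg_of_add_eq_zero_left h1, map_neg, neg_eq_zero] at h2
          exact h2
        rw [hz, add_zero] at h1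
        change l₁ w + M.cellForm k _ τ.1 z.1 = 0
        rw [hl₁ w h1, hz, map_zero, add_zero]
    refine ⟨R, fun w => ?_, fun z hz => ?_⟩
    · have := congrArg (fun φ : _ →ₗ[ℝ] ℝ => φ (w, 0)) hR
      have h2 : M.cellForm k _ R (comb (w, 0)) = l₁ w + M.cellForm k _ τ.1 0 := this
      have h3 : comb (w, 0) = pwJac ι (d + 1) m k w := by simp [comb]
      rw [h3, map_zero, add_zero] at h2
      exact h2
    · have := congrArg (fun φ : _ →ₗ[ℝ] ℝ => φ (0, ⟨z, hz⟩)) hR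
      have h2 : M.cellForm k _ R (comb (0, ⟨z, hz⟩)) = l₁ 0 + M.cellForm k _ τ.1 z := this
      have h3 : comb (0, ⟨z, hz⟩) = z := by simp [comb]
      rw [h3, map_zero, zero_add] at h2
      exact h2
  exact Classical.epsilon_spec hex

end Integrals

end Mesh

end Reconstruction

/-! ### Discrete integration by parts and the stabilization estimate -/

namespace Mesh

variable {d : ℕ} {Ω : Set (Vec (d + 1))} {ι κ : Type*} {m k : ℕ}

theorem integral_faceProj (M : Mesh (d + 1) Ω ι κ) (S : κ) {k' : ℕ}
    (p : polySpace (d + 1) k' (Fin m)) (q : polySpace (d + 1) k (Fin m)) :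
    ∫ x, inner ℝ ((l2Proj k (M.surf S) p.1).1 x) (q.1 x) ∂(M.surf S) =
      ∫ x, inner ℝ (p.1 x) (q.1 x) ∂(M.surf S) :=
  l2Proj_spec (fun _ hg => M.integrable_surf S hg)
    (fun q => M.integrable_surf S ((continuous_poly p).inner (continuous_poly q))) q

/-- The normal flux residual `τ_S - (R_h^* τ)|_K ν_S`. -/
noncomputable def fluxDiff [Fintype ι] [Fintype κ] (M : Mesh (d + 1) Ω ι κ)
    (τ : DualSpace ι κ (d + 1) m k) (K : ι) (S : κ) : polySpace (d + 1) k (Fin m) :=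
  τ.2 S - mulVecPoly k (M.normal S) (M.dualPotRec τ K)

/-- The trace residual `v_S - Π_S^k v_K`. -/
noncomputable def traceDiff (M : Mesh (d + 1) Ω ι κ)
    (v : PrimalSpace ι κ (d + 1) m k) (K : ι) (S : κ) : polySpace (d + 1) k (Fin m) :=
  v.2 S - l2Proj k (M.surf S) (v.1 K).1

theorem traceDiff_apply (M : Mesh (d + 1) Ω ι κ) (v : PrimalSpace ι κ (d + 1) m k) (K : ι)
    (S : κ) : (M.traceDiff v K S).1 = M.faceDiff v K S := rfl

/-- The normal is constant on S, so the flux residual has degree at most k and the projection in the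
trace residual drops out; the rest is bilinear expansion. -/
theorem integral_traceDiff_fluxDiff [Fintype ι] [Fintype κ] (M : Mesh (d + 1) Ω ι κ)
    (v : PrimalSpace ι κ (d + 1) m k) (τ : DualSpace ι κ (d + 1) m k) (K : ι) (S : κ) :
    ∫ x, inner ℝ ((M.traceDiff v K S).1 x) ((M.fluxDiff τ K S).1 x) ∂(M.surf S) =
      ∫ x, inner ℝ ((v.2 S).1 x) ((τ.2 S).1 x) ∂(M.surf S) -
      ∫ x, inner ℝ ((v.2 S).1 x) (mulVec ((M.dualPotRec τ K).1 x) (M.normal S)) ∂(M.surf S) -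
      ∫ x, inner ℝ ((v.1 K).1 x) ((τ.2 S).1 x) ∂(M.surf S) +
      ∫ x, inner ℝ ((v.1 K).1 x) (mulVec ((M.dualPotRec τ K).1 x) (M.normal S)) ∂(M.surf S) := by
  have hi : ∀ {k₁ k₂ : ℕ} (p : polySpace (d + 1) k₁ (Fin m)) (q : polySpace (d + 1) k₂ (Fin m)),
      Integrable (fun x => inner ℝ (p.1 x) (q.1 x)) (M.surf S) := fun p q =>
    M.integrable_surf S ((continuous_poly p).inner (continuous_poly q))
  have hsub : ∀ {k₁ : ℕ} (p : polySpace (d + 1) k₁ (Fin m)),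
      ∫ x, inner ℝ (p.1 x) ((M.fluxDiff τ K S).1 x) ∂(M.surf S) =
      ∫ x, inner ℝ (p.1 x) ((τ.2 S).1 x) ∂(M.surf S) -
      ∫ x, inner ℝ (p.1 x) (mulVec ((M.dualPotRec τ K).1 x) (M.normal S)) ∂(M.surf S) := by
    intro k₁ p
    simp_rw [← mulVecPoly_apply]
    rw [← integral_sub (hi _ _) (hi _ _)]
    simp_rw [← inner_sub_right]
    rfl
  have h1 : ∫ x, inner ℝ ((M.traceDiff v K S).1 x) ((M.fluxDiff τ K S).1 x) ∂(M.surf S) =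
      ∫ x, inner ℝ ((v.2 S).1 x) ((M.fluxDiff τ K S).1 x) ∂(M.surf S) -
      ∫ x, inner ℝ ((l2Proj k (M.surf S) (v.1 K).1).1 x) ((M.fluxDiff τ K S).1 x) ∂(M.surf S) := by
    rw [← integral_sub (hi _ _) (hi _ _)]
    simp_rw [← inner_sub_left]
    rfl
  rw [h1, M.integral_faceProj, hsub, hsub]
  ring

/-- The discrete integration by parts formula behind the weak duality. -/
theorem reconstruction_pairing [Fintype ι] [Fintype κ] (M : Mesh (d + 1) Ω ι κ)
    (hΩ_open : IsOpen Ω) (hΩ_reg : interior (closure Ω) = Ω) {ΓD : Set (Vec (d + 1))}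
    {v : PrimalSpace ι κ (d + 1) m k} (hv : v ∈ M.VD ΓD)
    {τ : DualSpace ι κ (d + 1) m k} (hτ : τ ∈ M.WN ΓD) :
    M.cellInt (fun K x => inner ℝ ((M.gradRec v K).1 x) ((M.dualPotRec τ K).1 x)) +
      M.cellInt (fun K x => inner ℝ ((M.cellProj v K).1 x) ((M.divRec τ K).1 x)) =
      - ∑ S, M.jump S fun K =>
        ∫ x, inner ℝ ((M.traceDiff v K S).1 x) ((M.fluxDiff τ K S).1 x) ∂(M.surf S) := by
  set R := M.dualPotRec τ with hR
  have e1 := M.isGradRec_gradRec v R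
  have e2 : M.cellInt (fun K x => inner ℝ ((v.1 K).1 x) (dvg (R K).1 x)) +
      M.cellInt (fun K x => inner ℝ (jac (v.1 K).1 x) ((R K).1 x)) =
      ∑ S, M.jump S fun K =>
        ∫ x, inner ℝ ((v.1 K).1 x) (mulVec ((R K).1 x) (M.normal S)) ∂(M.surf S) := by
    simp_rw [jump_eq_sum]
    rw [Finset.sum_comm, cellInt, cellInt, ← Finset.sum_add_distrib]
    exact Finset.sum_congr rfl fun K _ =>
      M.integral_cell_by_parts hΩ_open hΩ_reg K (v.1 K) (R K)
  have e3 := (M.isDualPotRec_dualPotRec τ).1 v.1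
  rw [← hR] at e3
  have e3' : M.cellInt (fun K x => inner ℝ ((R K).1 x) (jac (v.1 K).1 x)) =
      M.cellInt (fun K x => inner ℝ (jac (v.1 K).1 x) ((R K).1 x)) := by
    simp_rw [real_inner_comm]
  -- The projection drops out because div_h τ is piecewise of degree at most k.
  have e4 : M.cellInt (fun K x => inner ℝ ((M.cellProj v K).1 x) ((M.divRec τ K).1 x)) =
      M.cellInt (fun K x => inner ℝ ((v.1 K).1 x) ((M.divRec τ K).1 x)) :=
    Finset.sum_congr rfl fun K _ =>
      l2Proj_spec (fun _ hg => M.integrableOn_cell K hg)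
        (fun q => M.integrableOn_cell K ((continuous_poly _).inner (continuous_poly q))) _
  have hi : ∀ (S : κ) {k₁ k₂ : ℕ} (p : polySpace (d + 1) k₁ (Fin m))
      (q : polySpace (d + 1) k₂ (Fin m)),
      Integrable (fun x => inner ℝ (p.1 x) (q.1 x)) (M.surf S) := fun S _ _ p q =>
    M.integrable_surf S ((continuous_poly p).inner (continuous_poly q))
  -- The only use of the boundary conditions: on each boundary face one of v_S and τ_S vanishes.
  have hbd : ∀ S, M.minus S = none → ∫ x, inner ℝ ((v.2 S).1 x) ((τ.2 S).1 x) ∂(M.surf S) = 0 := by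
    intro S hS
    refine integral_eq_zero_of_ae ((ae_restrict_iff' (M.face_closed S).measurableSet).2
      (Eventually.of_forall fun x hx => ?_))
    by_cases hD : M.IsDirichlet ΓD S
    · simp [hv S hD x hx]
    · simp [hτ S ⟨hS, hD⟩ x hx]
  have hS : M.faceInt (fun S x => inner ℝ (M.jump S fun K => (v.1 K).1 x) ((τ.2 S).1 x)) +
      M.faceInt (fun S x =>
          inner ℝ ((v.2 S).1 x) (M.jump S fun K => mulVec ((R K).1 x) (M.normal S))) -
      ∑ S, M.jump S (fun K =>
        ∫ x, inner ℝ ((v.1 K).1 x) (mulVec ((R K).1 x) (M.normal S)) ∂(M.surf S)) =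
      - ∑ S, M.jump S fun K =>
        ∫ x, inner ℝ ((M.traceDiff v K S).1 x) ((M.fluxDiff τ K S).1 x) ∂(M.surf S) := by
    rw [faceInt, faceInt, ← Finset.sum_add_distrib, ← Finset.sum_sub_distrib,
      ← Finset.sum_neg_distrib]
    refine Finset.sum_congr rfl fun S _ => ?_
    simp_rw [integral_traceDiff_fluxDiff, ← hR]
    rcases hmin : M.minus S with _ | L
    · simp only [jump, hmin, Option.elim_none, sub_zero, hbd S hmin]
      ring
    · simp only [jump, hmin, Option.elim_some, inner_sub_left, inner_sub_right]
      simp_rw [← mulVecPoly_apply]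
      rw [integral_sub (hi S _ _) (hi S _ _), integral_sub (hi S _ _) (hi S _ _)]
      ring
  linarith

/-- The outer projection is tested with v_S - Π_S^k v_K, itself of degree at most k, and can be
removed. Thus s_h(v; v) is a weighted sum of r-th powers of L^r norms. -/
theorem integral_traceOp [Fintype ι] [Fintype κ] (M : Mesh (d + 1) Ω ι κ) {r : ℝ} (hr : 1 < r)
    (v : PrimalSpace ι κ (d + 1) m k) (K : ι) (S : κ) :
    ∫ x, inner ℝ ((M.traceOp r v K S).1 x) (M.faceDiff v K S x) ∂(M.surf S) =
      ∫ x, ‖M.faceDiff v K S x‖ ^ r ∂(M.surf S) := by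
  have hc : Continuous (M.faceDiff v K S) := continuous_poly (M.traceDiff v K S)
  have hmeas : Measurable fun x => ‖M.faceDiff v K S x‖ ^ (r - 2) • M.faceDiff v K S x :=
    (hc.norm.measurable.pow_const _).smul hc.measurable
  have h := l2Proj_spec (k := k) (μ := M.surf S) (fun _ hg => M.integrable_surf S hg)
    (f := fun x => ‖M.faceDiff v K S x‖ ^ (r - 2) • M.faceDiff v K S x) (fun q => by
      -- For r < 2 the factor with exponent r - 2 is singular at zeros of the residual, but the
      -- product is dominated by the exponent r - 1 > 0, which is continuous.
      refine M.integrable_surf_of_le S (g := fun x => ‖M.faceDiff v K S x‖ ^ (r - 1) * ‖q.1 x‖)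
        (hmeas.inner (continuous_poly q).measurable).aestronglyMeasurable
        ((hc.norm.rpow_const fun x => Or.inr (by linarith)).mul (continuous_poly q).norm)
        fun x => ?_
      refine (norm_inner_le_norm _ _).trans (mul_le_mul_of_nonneg_right ?_ (norm_nonneg _))
      rw [norm_smul, Real.norm_of_nonneg (by positivity)]
      rcases eq_or_lt_of_le (norm_nonneg (M.faceDiff v K S x)) with h0 | h0
      · rw [← h0, mul_zero]; positivity
      · rw [show r - 1 = (r - 2) + 1 by ring, Real.rpow_add_one h0.ne'])
    (M.traceDiff v K S)
  rw [traceDiff_apply] at h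
  refine h.trans (integral_congr_ae (Eventually.of_forall fun x => ?_))
  simp only [real_inner_smul_left, real_inner_self_eq_norm_sq]
  rcases eq_or_lt_of_le (norm_nonneg (M.faceDiff v K S x)) with h0 | h0
  · rw [← h0, Real.zero_rpow (by linarith : r ≠ 0)]; simp
  · rw [← Real.rpow_natCast, ← Real.rpow_add h0]
    congr 1; push_cast; ring

/-- Young's inequality with the weights of the stabilizations. -/
theorem weighted_young {a b h r s : ℝ} (ha : 0 ≤ a) (hb : 0 ≤ b) (hh : 0 < h) (hr : 1 < r) :
    a * b ≤ h ^ (-s) * a ^ r / r + h ^ (s / (r - 1)) * b ^ (r / (r - 1)) / (r / (r - 1)) := by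
  have hr0 : 0 < r := by linarith
  have hr1 : 0 < r - 1 := by linarith
  have hpq : r.HolderConjugate (r / (r - 1)) := Real.HolderConjugate.conjExponent hr
  -- The weights multiply to 1, and their powers with exponents r and r' are h^(-s) and h^(s/(r-1)).
  have h1 := Real.young_inequality_of_nonneg (a := h ^ (-s / r) * a) (b := h ^ (s / r) * b)
    (by positivity) (by positivity) hpq
  rw [Real.mul_rpow (by positivity) ha, Real.mul_rpow (by positivity) hb,
    ← Real.rpow_mul hh.le, ← Real.rpow_mul hh.le] at h1
  have e1 : -s / r * r = -s := by field_simp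
  have e2 : s / r * (r / (r - 1)) = s / (r - 1) := by field_simp
  have e3 : h ^ (-s / r) * a * (h ^ (s / r) * b) = a * b := by
    have : h ^ (-s / r) * h ^ (s / r) = 1 := by
      rw [← Real.rpow_add hh]; ring_nf; simp
    calc _ = (h ^ (-s / r) * h ^ (s / r)) * (a * b) := by ring
      _ = a * b := by rw [this, one_mul]
  rwa [e1, e2, e3] at h1

theorem abs_integral_traceDiff_fluxDiff_le [Fintype ι] [Fintype κ] (M : Mesh (d + 1) Ω ι κ)
    (hd : 1 ≤ d) {r : ℝ} (s : ℝ) (hr : 1 < r) (v : PrimalSpace ι κ (d + 1) m k)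
    (τ : DualSpace ι κ (d + 1) m k) (K : ι) (S : κ) :
    |∫ x, inner ℝ ((M.traceDiff v K S).1 x) ((M.fluxDiff τ K S).1 x) ∂(M.surf S)| ≤
      Metric.diam (M.face S) ^ (-s) *
        (∫ x, inner ℝ ((M.traceOp r v K S).1 x) (M.faceDiff v K S x) ∂(M.surf S)) / r +
      Metric.diam (M.face S) ^ (s / (r - 1)) *
        (∫ x, ‖(τ.2 S).1 x - mulVec ((M.dualPotRec τ K).1 x) (M.normal S)‖ ^ (r / (r - 1))
          ∂(M.surf S)) / (r / (r - 1)) := by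
  have hc1 := continuous_poly (M.traceDiff v K S)
  have hc2 := continuous_poly (M.fluxDiff τ K S)
  have hr1 : 0 < r - 1 := by linarith
  have hi1 : Integrable (fun x => ‖(M.traceDiff v K S).1 x‖ ^ r) (M.surf S) :=
    M.integrable_surf S (hc1.norm.rpow_const fun x => Or.inr (by linarith))
  have hi2 : Integrable (fun x => ‖(M.fluxDiff τ K S).1 x‖ ^ (r / (r - 1))) (M.surf S) :=
    M.integrable_surf S (hc2.norm.rpow_const fun x => Or.inr (by positivity))
  rw [M.integral_traceOp hr]
  change _ ≤ _ * (∫ x, ‖(M.traceDiff v K S).1 x‖ ^ r ∂(M.surf S)) / r + _ *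
    (∫ x, ‖(M.fluxDiff τ K S).1 x‖ ^ (r / (r - 1)) ∂(M.surf S)) / (r / (r - 1))
  rw [← integral_const_mul, ← integral_const_mul, ← integral_div, ← integral_div,
    ← integral_add ((hi1.const_mul _).div_const _) ((hi2.const_mul _).div_const _),
    ← Real.norm_eq_abs]
  refine norm_integral_le_of_norm_le
    (((hi1.const_mul _).div_const _).add ((hi2.const_mul _).div_const _))
    (Eventually.of_forall fun x => ?_)
  exact (norm_inner_le_norm _ _).trans
    (weighted_young (norm_nonneg _) (norm_nonneg _) (M.diam_face_pos hd S) hr)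

theorem abs_orient_le (M : Mesh (d + 1) Ω ι κ) (K : ι) (S : κ) : |M.orient K S| ≤ 1 := by
  by_cases h : M.orient K S = 0
  · simp [h]
  · rcases M.orient_eq_one_or h with h | h <;> simp [h]

theorem face_subset_of_orient_ne_zero (M : Mesh (d + 1) Ω ι κ) {K : ι} {S : κ}
    (h : M.orient K S ≠ 0) : M.face S ⊆ frontier (M.cell K) := by
  by_cases hp : M.plus S = K
  · exact hp ▸ (M.plus_normal S).2.1
  by_cases hm : M.minus S = some K
  · exact (M.minus_normal S K hm).2.1
  exact absurd (M.orient_eq_zero hp hm) h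

/-- The real-valued inequality behind the weak duality. -/
theorem reconstruction_pairing_nonneg [Fintype ι] [Fintype κ] (M : Mesh (d + 1) Ω ι κ)
    (hd : 1 ≤ d) (hΩ_open : IsOpen Ω) (hΩ_reg : interior (closure Ω) = Ω)
    {ΓD : Set (Vec (d + 1))} {r : ℝ} (s : ℝ) (hr : 1 < r)
    {v : PrimalSpace ι κ (d + 1) m k} (hv : v ∈ M.VD ΓD)
    {τ : DualSpace ι κ (d + 1) m k} (hτ : τ ∈ M.WN ΓD) :
    0 ≤ M.cellInt (fun K x => inner ℝ ((M.gradRec v K).1 x) ((M.dualPotRec τ K).1 x)) +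
      M.cellInt (fun K x => inner ℝ ((M.cellProj v K).1 x) ((M.divRec τ K).1 x)) +
      M.stab r s v v / r + M.dualStab r s τ / (r / (r - 1)) := by
  rw [M.reconstruction_pairing hΩ_open hΩ_reg hv hτ]
  set E : ι → κ → ℝ := fun K S =>
    ∫ x, inner ℝ ((M.traceDiff v K S).1 x) ((M.fluxDiff τ K S).1 x) ∂(M.surf S) with hE
  have hsum : ∑ S, M.jump S (fun K => E K S) ≤ ∑ K, ∑ S ∈ M.facesOf K, |E K S| := by
    simp_rw [jump_eq_sum]
    rw [Finset.sum_comm]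
    refine Finset.sum_le_sum fun K _ => ?_
    -- Faces outside Σ(K) have orientation zero. Further faces in Σ(K) would do no harm, because
    -- their terms on the right are nonnegative.
    rw [← Finset.sum_subset (Finset.subset_univ (M.facesOf K))]
    · refine Finset.sum_le_sum fun S _ => ?_
      calc M.orient K S * E K S ≤ |M.orient K S * E K S| := le_abs_self _
        _ = |M.orient K S| * |E K S| := abs_mul _ _
        _ ≤ 1 * |E K S| := mul_le_mul_of_nonneg_right (M.abs_orient_le K S) (abs_nonneg _)
        _ = |E K S| := one_mul _
    · intro S _ hS
      by_cases h : M.orient K S = 0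
      · simp [h]
      · exact absurd (by simpa [facesOf] using M.face_subset_of_orient_ne_zero h) hS
  have hle : ∑ K, ∑ S ∈ M.facesOf K, |E K S| ≤
      M.stab r s v v / r + M.dualStab r s τ / (r / (r - 1)) := by
    rw [stab, dualStab, Finset.sum_div, Finset.sum_div, ← Finset.sum_add_distrib]
    refine Finset.sum_le_sum fun K _ => ?_
    rw [Finset.sum_div, Finset.sum_div, ← Finset.sum_add_distrib]
    exact Finset.sum_le_sum fun S _ =>
      M.abs_integral_traceDiff_fluxDiff_le hd s hr v τ K S
  linarith

end Mesh

/-! ### Fenchel-Young and extended-real integrals -/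

section ExtIntegral

theorem conj_ne_bot {X : Type*} [NormedAddCommGroup X] [InnerProductSpace ℝ X] {φ : X → EReal}
    (hφ : IsProperConvexLSC φ) (g : X) : conj φ g ≠ ⊥ := by
  obtain ⟨a, ha⟩ := hφ.exists_ne_top
  intro h
  have h1 : ((inner ℝ a g : ℝ) : EReal) - φ a ≤ conj φ g :=
    le_iSup (fun a : X => ((inner ℝ a g : ℝ) : EReal) - φ a) a
  lift φ a to ℝ using ⟨ha, hφ.ne_bot a⟩ with y
  rw [h, le_bot_iff, ← EReal.coe_sub] at h1
  exact EReal.coe_ne_bot _ h1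

/-- The Fenchel-Young inequality. -/
theorem inner_le_add_conj {X : Type*} [NormedAddCommGroup X] [InnerProductSpace ℝ X] {φ : X → EReal}
    (hφ : IsProperConvexLSC φ) (a g : X) : ((inner ℝ a g : ℝ) : EReal) ≤ φ a + conj φ g := by
  have h1 : ((inner ℝ a g : ℝ) : EReal) - φ a ≤ conj φ g :=
    le_iSup (fun a : X => ((inner ℝ a g : ℝ) : EReal) - φ a) a
  rw [EReal.sub_le_iff_le_add (Or.inl (hφ.ne_bot a)) (Or.inr (conj_ne_bot hφ g))] at h1
  rwa [add_comm]

/-- The inequality q ≤ a + b with positive and negative parts moved to the sides where they are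
added, so that it remains meaningful for infinite values and can be integrated in `ENNReal`. -/
theorem toENNReal_add_le_of_le_add {a b : EReal} {q : ℝ} (ha : a ≠ ⊥) (hb : b ≠ ⊥)
    (h : (q : EReal) ≤ a + b) :
    ENNReal.ofReal q + (-a).toENNReal + (-b).toENNReal ≤
      ENNReal.ofReal (-q) + a.toENNReal + b.toENNReal := by
  induction a with
  | bot => exact absurd rfl ha
  | top => simp
  | coe a =>
    induction b with
    | bot => exact absurd rfl hb
    | top => simp
    | coe b =>
      rw [← EReal.coe_add, EReal.coe_le_coe_iff] at h
      rw [← EReal.coe_neg, ← EReal.coe_neg]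
      simp only [EReal.real_coe_toENNReal]
      have e : ∀ x : ℝ, ENNReal.ofReal x = ENNReal.ofReal (max x 0) := fun x => by
        rcases le_total x 0 with hx | hx
        · rw [max_eq_right hx, ENNReal.ofReal_of_nonpos hx, ENNReal.ofReal_zero]
        · rw [max_eq_left hx]
      simp only [e q, e (-q), e a, e (-a), e b, e (-b)]
      rw [← ENNReal.ofReal_add (by positivity) (by positivity),
        ← ENNReal.ofReal_add (by positivity) (by positivity),
        ← ENNReal.ofReal_add (by positivity) (by positivity),
        ← ENNReal.ofReal_add (by positivity) (by positivity)]
      have e' : ∀ x : ℝ, max x 0 = x + max (-x) 0 := fun x => by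
        rcases le_total x 0 with hx | hx
        · rw [max_eq_right hx, max_eq_left (by linarith)]; ring
        · rw [max_eq_left hx, max_eq_right (by linarith)]; ring
      apply ENNReal.ofReal_le_ofReal
      linarith [e' q, e' a, e' b]

/-- Weak duality for extended integrals. -/
theorem neg_extIntegral_sub_le {X : Type*} [MeasurableSpace X] {μ : Measure X} {f g : X → EReal}
    {q : X → ℝ} (hq : Integrable q μ) (hf : AEMeasurable f μ)
    (h : ∀ᵐ x ∂μ, f x ≠ ⊥ ∧ g x ≠ ⊥ ∧ (q x : EReal) ≤ f x + g x) {a b : ℝ}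
    (hab : 0 ≤ ∫ x, q x ∂μ + a + b) :
    - extIntegral μ g - (b : EReal) ≤ extIntegral μ f + (a : EReal) := by
  -- If a positive part has infinite integral, the convention makes the right side +∞ or the left
  -- side -∞.
  by_cases hf1 : ∫⁻ x, (f x).toENNReal ∂μ = ⊤
  · simp [extIntegral, hf1]
  by_cases hg1 : ∫⁻ x, (g x).toENNReal ∂μ = ⊤
  · simp [extIntegral, hg1]
  have hq2 := hq.neg.lintegral_lt_top
  simp only [Pi.neg_apply] at hq2
  have key : ∫⁻ x, ENNReal.ofReal (q x) ∂μ + ∫⁻ x, (-f x).toENNReal ∂μ +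
      ∫⁻ x, (-g x).toENNReal ∂μ ≤
      ∫⁻ x, ENNReal.ofReal (-q x) ∂μ + ∫⁻ x, (f x).toENNReal ∂μ + ∫⁻ x, (g x).toENNReal ∂μ := by
    have hm1 : AEMeasurable (fun x => ENNReal.ofReal (-q x)) μ := hq.neg.aemeasurable.ennreal_ofReal
    have hm2 : AEMeasurable (fun x => (f x).toENNReal) μ := hf.ereal_toENNReal
    -- The lower integral is superadditive without measurability, and on the other side splitting
    -- needs only `q` and `f` measurable. Hence the conjugate density `g` may be arbitrary.
    calc _ ≤ ∫⁻ x, (ENNReal.ofReal (q x) + (-f x).toENNReal + (-g x).toENNReal) ∂μ :=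
          (add_le_add_left (le_lintegral_add _ _) _).trans (le_lintegral_add _ _)
      _ ≤ ∫⁻ x, (ENNReal.ofReal (-q x) + (f x).toENNReal + (g x).toENNReal) ∂μ :=
          lintegral_mono_ae (h.mono fun x hx => toENNReal_add_le_of_le_add hx.1 hx.2.1 hx.2.2)
      _ = _ := by
          have hm3 : AEMeasurable (fun x => ENNReal.ofReal (-q x) + (f x).toENNReal) μ := hm1.add hm2
          rw [lintegral_add_left' hm3, lintegral_add_left' hm1]
  have hint := integral_eq_lintegral_pos_part_sub_lintegral_neg_part hq
  simp only [extIntegral, hf1, hg1, if_false]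
  -- With finite positive parts, `key` also bounds the negative parts, so only real arithmetic
  -- remains.
  have hfin : ∫⁻ x, ENNReal.ofReal (q x) ∂μ + ∫⁻ x, (-f x).toENNReal ∂μ +
      ∫⁻ x, (-g x).toENNReal ∂μ < ⊤ :=
    key.trans_lt (ENNReal.add_lt_top.2 ⟨ENNReal.add_lt_top.2 ⟨hq2, lt_top_iff_ne_top.2 hf1⟩,
      lt_top_iff_ne_top.2 hg1⟩)
  rw [ENNReal.add_lt_top, ENNReal.add_lt_top] at hfin
  generalize ∫⁻ x, ENNReal.ofReal (q x) ∂μ = A at *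
  generalize ∫⁻ x, ENNReal.ofReal (-q x) ∂μ = A' at *
  generalize ∫⁻ x, (f x).toENNReal ∂μ = B at *
  generalize ∫⁻ x, (-f x).toENNReal ∂μ = B' at *
  generalize ∫⁻ x, (g x).toENNReal ∂μ = C at *
  generalize ∫⁻ x, (-g x).toENNReal ∂μ = C' at *
  obtain ⟨⟨hA, hB'⟩, hC'⟩ := hfin
  lift A to NNReal using hA.ne
  lift A' to NNReal using hq2.ne
  lift B to NNReal using hf1
  lift B' to NNReal using hB'.ne
  lift C to NNReal using hg1
  lift C' to NNReal using hC'.ne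
  have key' : (A : ℝ) + B' + C' ≤ A' + B + C := by exact_mod_cast key
  simp only [ENNReal.coe_toReal] at hint
  have e : ∀ x : NNReal, ((x : ENNReal) : EReal) = ((x : ℝ) : EReal) := fun x => rfl
  simp only [e]
  rw [← EReal.coe_sub, ← EReal.coe_sub, ← EReal.coe_neg, ← EReal.coe_sub, ← EReal.coe_add,
    EReal.coe_le_coe_iff]
  linarith

end ExtIntegral

/-! ### Integrals over Ω of glued piecewise polynomials -/

namespace Mesh

variable {d : ℕ} {Ω : Set (Vec (d + 1))} {ι κ : Type*} [Fintype ι]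

theorem measurable_glue (M : Mesh (d + 1) Ω ι κ) {k : ℕ} {J : Type*} [Fintype J]
    (p : PwPoly ι (d + 1) k J) : Measurable (M.glue p) :=
  Finset.measurable_sum _ fun K _ =>
    (continuous_poly (p K)).measurable.indicator (M.isCompact_cell K).isClosed.measurableSet

theorem glue_ae_eq (M : Mesh (d + 1) Ω ι κ) {k : ℕ} {J : Type*}
    (p : PwPoly ι (d + 1) k J) (K : ι) :
    ∀ᵐ x ∂(volume.restrict (M.cell K)), M.glue p x = (p K).1 x := by
  have hnull : volume (⋃ L : {L // L ≠ K}, M.cell K ∩ M.cell L.1) = 0 :=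
    measure_iUnion_null fun L => M.cell_overlap L.2.symm
  refine (ae_restrict_iff' (M.isCompact_cell K).isClosed.measurableSet).2 ?_
  filter_upwards [compl_mem_ae_iff.2 hnull] with x hx hxK
  unfold glue
  rw [Finset.sum_eq_single K]
  · exact Set.indicator_of_mem hxK _
  · intro L _ hL
    refine Set.indicator_of_notMem (fun hxL => hx (mem_iUnion.2 ⟨⟨L, hL⟩, hxK, hxL⟩)) _
  · simp

/-- Ω agrees with the union of the cells up to its null frontier, and the cells overlap in null
sets. -/
theorem integral_glue [Fintype κ] (M : Mesh (d + 1) Ω ι κ) (hΩ_open : IsOpen Ω)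
    (hΩ_reg : interior (closure Ω) = Ω) {k k' : ℕ} {J : Type*} [Fintype J]
    (p : PwPoly ι (d + 1) k J) (q : PwPoly ι (d + 1) k' J) :
    IntegrableOn (fun x => inner ℝ (M.glue p x) (M.glue q x)) Ω ∧
    ∫ x in Ω, inner ℝ (M.glue p x) (M.glue q x) =
      M.cellInt fun K x => inner ℝ ((p K).1 x) ((q K).1 x) := by
  have hae : Ω =ᵐ[volume] ⋃ K, M.cell K := by
    rw [M.cell_cover]
    refine subset_closure.eventuallyLE.antisymm ?_
    have hfr : volume (frontier Ω) = 0 := M.volume_frontier_domain hΩ_open hΩ_reg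
    filter_upwards [compl_mem_ae_iff.2 hfr] with x hx hxc
    by_contra hxΩ
    exact hx ⟨hxc, by rwa [hΩ_open.interior_eq]⟩
  have hcell : ∀ K, (fun x => inner ℝ (M.glue p x) (M.glue q x)) =ᵐ[volume.restrict (M.cell K)]
      fun x => inner ℝ ((p K).1 x) ((q K).1 x) := fun K => by
    filter_upwards [M.glue_ae_eq p K, M.glue_ae_eq q K] with x h1 h2
    rw [h1, h2]
  have hi : ∀ K, IntegrableOn (fun x => inner ℝ (M.glue p x) (M.glue q x)) (M.cell K) := fun K =>
    (M.integrableOn_cell K ((continuous_poly _).inner (continuous_poly _))).congr (hcell K).symm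
  have hiU : IntegrableOn (fun x => inner ℝ (M.glue p x) (M.glue q x)) (⋃ K, M.cell K) :=
    integrableOn_finite_iUnion.2 hi
  refine ⟨hiU.congr_set_ae hae, ?_⟩
  rw [setIntegral_congr_set hae]
  have hs := hasSum_integral_iUnion_ae
    (fun K => (M.isCompact_cell K).isClosed.measurableSet.nullMeasurableSet)
    (fun K L hKL => M.cell_overlap hKL) hiU
  rw [← hs.tsum_eq, tsum_fintype]
  exact Finset.sum_congr rfl fun K _ => integral_congr_ae (hcell K)

end Mesh

end HHO

/-! ### The weak duality inequality -/

theorem theorem3p1 {n m : ℕ} (hn : 2 ≤ n) (k : ℕ)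
    -- the domain and its Dirichlet boundary
    (Ω ΓD : Set (HHO.Vec n)) (hΩ_open : IsOpen Ω) (hΩ_bdd : Bornology.IsBounded Ω)
    (hΩ_reg : interior (closure Ω) = Ω)
    (hΓ_closed : IsClosed ΓD) (hΓ_sub : ΓD ⊆ frontier Ω) (hΓ_ne : ΓD.Nonempty)
    -- the mesh, with finitely many cells and faces
    {ι κ : Type*} [Fintype ι] [Fintype κ] (M : HHO.Mesh n Ω ι κ)
    -- the energy densities
    (Ψ : HHO.Mat m n → EReal) (hΨ : HHO.IsProperConvexLSC Ψ)
    (ψ : HHO.Vec n → HHO.Vec m → EReal)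
    (hψ_meas : Measurable fun z : MeasureTheory.NullMeasurableSpace (HHO.Vec n)
      (MeasureTheory.volume.restrict Ω) × HHO.Vec m => ψ z.1 z.2)
    (hψ : ∀ᵐ x ∂(MeasureTheory.volume.restrict Ω), HHO.IsProperConvexLSC (ψ x))
    -- the parameters of the stabilization
    (r s : ℝ) (hr : 1 < r) :
    (⨆ τ ∈ M.WN (m := m) (k := k) ΓD, M.dualEnergy Ψ ψ r s τ) ≤
      ⨅ v ∈ M.VD (m := m) (k := k) ΓD, M.primalEnergy Ψ ψ r s v := by
  obtain ⟨d, rfl⟩ : ∃ d, n = d + 1 := ⟨n - 1, by omega⟩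
  refine iSup₂_le fun τ hτ => le_iInf₂ fun v hv => ?_
  obtain ⟨hi1, he1⟩ := M.integral_glue hΩ_open hΩ_reg (M.gradRec v) (M.dualPotRec τ)
  obtain ⟨hi2, he2⟩ := M.integral_glue hΩ_open hΩ_reg (M.cellProj v) (M.divRec τ)
  have hmeas : AEMeasurable (fun x => Ψ (M.glue (M.gradRec v) x) + ψ x (M.glue (M.cellProj v) x))
      (volume.restrict Ω) := by
    have h1 : Measurable fun x => Ψ (M.glue (M.gradRec v) x) :=
      hΨ.lsc.measurable.comp (M.measurable_glue _)
    -- Joint measurability refers to the completed σ-algebra on Ω, so composition with x ↦ (x, Π^k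
    -- v(x)) gives only null-measurability; this suffices for `AEMeasurable`.
    have h2 : NullMeasurable (fun x => ψ x (M.glue (M.cellProj v) x)) (volume.restrict Ω) := by
      have h3 : Measurable fun x : NullMeasurableSpace (HHO.Vec (d + 1)) (volume.restrict Ω) =>
          ((x, M.glue (M.cellProj v) x) :
            NullMeasurableSpace (HHO.Vec (d + 1)) (volume.restrict Ω) × HHO.Vec m) :=
        measurable_id.prodMk ((M.measurable_glue (M.cellProj v)).nullMeasurable
          (μ := volume.restrict Ω)).measurable'
      exact hψ_meas.comp h3
    exact h1.aemeasurable.add h2.aemeasurable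
  -- Here q is D_h v : R_h^* τ + Π^k v · div_h τ. The remaining goals are the pointwise
  -- Fenchel-Young bound and the lower bound for the integral of q.
  refine HHO.neg_extIntegral_sub_le (hi1.add hi2) hmeas ?_ ?_
  · filter_upwards [hψ] with x hx
    refine ⟨?_, ?_, ?_⟩
    · exact EReal.add_ne_bot_iff.2 ⟨hΨ.ne_bot _, hx.ne_bot _⟩
    · exact EReal.add_ne_bot_iff.2 ⟨HHO.conj_ne_bot hΨ _, HHO.conj_ne_bot hx _⟩
    · rw [Pi.add_apply, EReal.coe_add, add_add_add_comm]
      exact add_le_add (HHO.inner_le_add_conj hΨ _ _) (HHO.inner_le_add_conj hx _ _)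
  · simp only [Pi.add_apply]
    rw [integral_add hi1 hi2, he1, he2]
    exact M.reconstruction_pairing_nonneg (by omega) hΩ_open hΩ_reg s hr hv hτ
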